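/- **Setting.** Let $\alpha,\beta\in\mathbb R\setminus\{0\}$ (the coupled dispersive AB system is $A_{xt}-\alpha A-\beta AB=0$, $B_x+\frac{\gamma}{2}(|A|^2)_t=0$ with $\beta\gamma=1$). Let $k_1,\dots,k_N\in\mathbb C^+$ be distinct, $\mathcal K=\{k_j\}$, $c_1,\dots,c_N\in\mathbb C\setminus\{0\}$, and let $r\in L^2(\mathbb R)$ be the reflection coefficient. Let $x_1<x_2$ and $v_1<v_2$ with $\alpha v_1<0$, $\alpha v_2<0$, and $$\mathcal C=\{(x,t): x=x_0+vt,\ x_0\in[x_1,x_2],\ v\in[v_1,v_2]\},\qquad f(v)=\Big(-\frac{\alpha}{4v}\Big)^{1/2},$$ $$\mathcal I=\{k: |k| \text{ strictly between } f(v_1)\text{ and }f(v_2)\},\qquad \mathcal K(\mathcal I)=\mathcal K\cap\mathcal I .$$ Put $v_{k_j}=-\alpha/(4|k_j|^2)$ and $\mu=\min_{k_j\in\mathcal K\setminus\mathcal K(\mathcal I)}\operatorname{Im}k_j\,\operatorname{dist}(v_{k_j},[v_1,v_2])$ ($\mu$ is an arbitrary real number if $\mathcal K\setminus\mathcal K(\mathcal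 I)=\emptyset$). **Discrete Riemann–Hilbert problem.** Let $t\theta(k)=kx-\frac{\alpha t}{4k}$. For an index set $S\subseteq\{1,\dots,N\}$, a set $\nabla\subseteq S$ and constants $(\kappa_j)_{j\in S}$, the matrix $M(x,t,k)$ is the solution of: $M$ is analytic in $k$ off $\{k_j,k_j^*\}_{j\in S}$; $M(k)=\sigma_0M^*(k^*)\sigma_0^{-1}$ with $\sigma_0=\begin{pmatrix}0&1\\-1&0\end{pmatrix}$; $M=I+\mathcal O(k^{-1})$ as $k\to\infty$; and at $k_j,k_j^*$ ($j\in S$) $M$ has at most simple poles, with $\operatorname{Res}_{k_j}M=\lim_{k\to k_j}M\Theta_j$ and $\operatorname{Res}_{k_j^*}M=\lim_{k\to k_j^*}M\Theta_j'$, where, if $j\in\nabla$, $$\Theta_j=\begin{pmatrix}0&\kappa_je^{-2it\theta(k_j)}\\0&0\end{pmatrix},\quad \Theta_j'=\begin{pmatrix}0&0\\-\kappa_j^*e^{2it\theta(k_j^*)}&0\end{pmatrix},$$ and, if $j\notin\nabla$, $$\Theta_j=\begin{pmatrix}0&0\\\kappa_je^{2it\theta(k_j)}&0\end{pmatrix},\quad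 \Theta_j'=\begin{pmatrix}0&-\kappa_j^*e^{-2it\theta(k_j^*)}\\0&0\end{pmatrix}.$$ The soliton solution with these data is $A_{sol}=4i\lim_{k\to\infty}[kM]_{12}$, $B_{sol}=-\frac{4i}{\beta}\lim_{k\to\infty}\frac{d}{dt}[kM]_{11}$, where the data $S,\nabla,(\kappa_j)$ are held fixed in $\frac{d}{dt}$. **Data.** For $(x,t)\in\mathcal C$ with $t$ large let $k_0=\sqrt{-\alpha t/(4x)}$, $\Delta^{-}_{k_0}=\{j:|k_j|<k_0\}$, $\Delta^+_{k_0}=\{j:|k_j|>k_0\}$, $s_{11,\nabla}(k)=\prod_{j\in\nabla}\frac{k-k_j}{k-k_j^*}$, and $$\delta(k)=\exp\Big[i\int_{I}\frac{\nu(s)}{s-k}\,ds\Big],\qquad \nu=-\tfrac1{2\pi}\log(1+|r|^2),$$ where $I=(-k_0,k_0)$, $\Delta=\Delta^-_{k_0}$ if $\alpha<0$, and $I=\{s\in\mathbb R:|s|>k_0\}$, $\Delta=\Delta^+_{k_0}$ if $\alpha>0$. For $\nabla\in\{\Delta^+_{k_0},\Delta^-_{k_0}\}$: * $\widetilde{\mathcal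 D}$ consists of $S=\{1,\dots,N\}$, $\nabla$, and $\kappa_j=c_j^{-1}s_{11,\nabla}'(k_j)^{-2}\delta(k_j)^2$ for $j\in\nabla$, $\kappa_j=c_js_{11,\nabla}(k_j)^2\delta(k_j)^{-2}$ for $j\notin\nabla$. * $\widetilde{\mathcal D}(\mathcal I)$ is built in the same way from $S=\{j:k_j\in\mathcal K(\mathcal I)\}$, the set $\nabla\cap S$ in place of $\nabla$, and, in place of $c_j$, $\;c_j(\mathcal I)=c_j\prod_{n\in\Delta,\ k_n\notin\mathcal I}\big(\frac{k_j-k_n}{k_j-k_n^*}\big)^2$. **Claim.** There are constants $C$ and $T>0$ such that for all $(x,t)\in\mathcal C$ with $t\ge T$ one has $-\alpha t/(4x)>0$, the Riemann–Hilbert problems with data $\widetilde{\mathcal D}$ and with data $\widetilde{\mathcal D}(\mathcal I)$ are uniquely solvable (for all real values of the space and time arguments), the limits and derivatives that define the soliton solutions at $(x,t)$ exist and do not depend on the choice of $\nabla\in\{\Delta^+_{k_0},\Delta^-_{k_0}\}$, and $$|A_{sol}(x,t|\widetilde{\mathcal D})-A_{sol}(x,t|\widetilde{\mathcal D}(\mathcal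 I))|\le Ce^{-2\mu t},\qquad |B_{sol}(x,t|\widetilde{\mathcal D})-B_{sol}(x,t|\widetilde{\mathcal D}(\mathcal I))|\le Ce^{-2\mu t}.$$ -/

import Mathlib

open Filter Topology MeasureTheory ComplexConjugate

noncomputable section

namespace ABSystem

variable {N : ℕ}

/-! Discrete (reflectionless) Riemann-Hilbert problems -/

/-- The phase `t θ(z) = z x - α t / (4 z)`. -/
def tTheta (α x t : ℝ) (z : ℂ) : ℂ := z * x - α * t / (4 * z)

/-- The Blaschke product `s_{11,∇}(z) = ∏_{j ∈ ∇} (z - k_j) / (z - k_j^*)`. -/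
def s11 (k : Fin N → ℂ) (nabla : Finset (Fin N)) (z : ℂ) : ℂ :=
  ∏ j ∈ nabla, (z - k j) / (z - conj (k j))

/-- Reflectionless scattering data: the eigenvalues `pole j` for `j ∈ index`, the constants
`coeff j` attached to them, and the set `nabla` of those `j` for which the second (instead of the
first) column of the solution is singular at `pole j`. -/
structure SolitonData (N : ℕ) where
  index : Finset (Fin N)
  pole : Fin N → ℂ
  coeff : Fin N → ℂ
  nabla : Finset (Fin N)

/-- The set of the eigenvalues and of their complex conjugates. -/
def SolitonData.poles (D : SolitonData N) : Set ℂ :=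
  {z | ∃ j ∈ D.index, z = D.pole j ∨ z = conj (D.pole j)}

/-- The nilpotent matrix in the residue condition at `k_j`. -/
def SolitonData.residueMatrix (D : SolitonData N) (α x t : ℝ) (j : Fin N) :
    Matrix (Fin 2) (Fin 2) ℂ :=
  if j ∈ D.nabla then
    !![0, D.coeff j * Complex.exp (-2 * Complex.I * tTheta α x t (D.pole j)); 0, 0]
  else
    !![0, 0; D.coeff j * Complex.exp (2 * Complex.I * tTheta α x t (D.pole j)), 0]

/-- The nilpotent matrix in the residue condition at `k_j^*`. -/
def SolitonData.residueMatrixConj (D : SolitonData N) (α x t : ℝ) (j : Fin N) :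
    Matrix (Fin 2) (Fin 2) ℂ :=
  if j ∈ D.nabla then
    !![0, 0;
      -conj (D.coeff j) * Complex.exp (2 * Complex.I * tTheta α x t (conj (D.pole j))), 0]
  else
    !![0, -conj (D.coeff j) * Complex.exp (-2 * Complex.I * tTheta α x t (conj (D.pole j)));
      0, 0]

/-- `M` has at most a simple pole at `p`, and `Res_{z = p} M = lim_{z → p} M(z) Θ`. -/
def HasResidueRelation (M : ℂ → Matrix (Fin 2) (Fin 2) ℂ) (p : ℂ)
    (Θ : Matrix (Fin 2) (Fin 2) ℂ) : Prop :=
  ∃ R : Matrix (Fin 2) (Fin 2) ℂ,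
    Tendsto (fun z => (z - p) • M z) (𝓝[≠] p) (𝓝 R) ∧
    Tendsto (fun z => M z * Θ) (𝓝[≠] p) (𝓝 R)

/-- The matrix `σ₀`. -/
def sigma0 : Matrix (Fin 2) (Fin 2) ℂ := !![0, 1; -1, 0]

/-- `M = M(x, t, ·)` solves the discrete Riemann-Hilbert problem with data `D` at `(x, t)`. -/
structure SolvesRHP (α : ℝ) (D : SolitonData N) (x t : ℝ)
    (M : ℂ → Matrix (Fin 2) (Fin 2) ℂ) : Prop where
  analytic : ∀ a b, DifferentiableOn ℂ (fun z => M z a b) D.polesᶜ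
  symmetry : ∀ z ∉ D.poles, M z = sigma0 * (M (conj z)).map conj * sigma0⁻¹
  asymptotics : ∀ a b, (fun z => M z a b - (1 : Matrix (Fin 2) (Fin 2) ℂ) a b)
    =O[Bornology.cobounded ℂ] fun z => z⁻¹
  residue : ∀ j ∈ D.index, HasResidueRelation M (D.pole j) (D.residueMatrix α x t j)
  residue_conj : ∀ j ∈ D.index,
    HasResidueRelation M (conj (D.pole j)) (D.residueMatrixConj α x t j)

/-- `A = 4 i lim_{z → ∞} [z M(x, t, z)]₁₂`. -/
def RecoversA (M : ℝ → ℝ → ℂ → Matrix (Fin 2) (Fin 2) ℂ) (x t : ℝ) (A : ℂ) : Prop :=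
  Tendsto (fun z => 4 * Complex.I * (z * M x t z 0 1)) (Bornology.cobounded ℂ) (𝓝 A)

/-- `B = -(4 i / β) lim_{z → ∞} d/dt [z M(x, t, z)]₁₁`, where the derivatives exist. -/
def RecoversB (β : ℝ) (M : ℝ → ℝ → ℂ → Matrix (Fin 2) (Fin 2) ℂ) (x t : ℝ) (B : ℂ) : Prop :=
  (∀ᶠ z in Bornology.cobounded ℂ, DifferentiableAt ℝ (fun τ : ℝ => z * M x τ z 0 0) t) ∧
  Tendsto (fun z => -(4 * Complex.I / β) * deriv (fun τ : ℝ => z * M x τ z 0 0) t)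
    (Bornology.cobounded ℂ) (𝓝 B)

/-- `A` and `B` are the values `A_sol(x, t | D)` and `B_sol(x, t | D)` at the point `(x, t)` of the
soliton solution with the (fixed) data `D`: the discrete Riemann-Hilbert problem is uniquely
solvable for all real arguments (its solution is determined off the poles), and `A` and `B` are
recovered from its solution. -/
structure IsSolitonValue (α β : ℝ) (D : SolitonData N) (x t : ℝ) (A B : ℂ) : Prop where
  exists_solution : ∃ M : ℝ → ℝ → ℂ → Matrix (Fin 2) (Fin 2) ℂ,
    ∀ y τ, SolvesRHP α D y τ (M y τ)
  unique_solution : ∀ (y τ : ℝ) (M M' : ℂ → Matrix (Fin 2) (Fin 2) ℂ),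
    SolvesRHP α D y τ M → SolvesRHP α D y τ M' → ∀ z ∉ D.poles, M z = M' z
  recovers : ∀ M : ℝ → ℝ → ℂ → Matrix (Fin 2) (Fin 2) ℂ,
    (∀ y τ, SolvesRHP α D y τ (M y τ)) → RecoversA M x t A ∧ RecoversB β M x t B

/-! Stationary points and the function `δ` -/

/-- The stationary phase point `k₀ = √(-α t / (4 x))`. -/
def k0 (α x t : ℝ) : ℝ := √(-(α * t) / (4 * x))

/-- `Δ⁻ = {j : |k_j| < κ}`. -/
def deltaMinus (k : Fin N → ℂ) (κ : ℝ) : Finset (Fin N) := {j | ‖k j‖ < κ}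

/-- `Δ⁺ = {j : |k_j| > κ}`. -/
def deltaPlus (k : Fin N → ℂ) (κ : ℝ) : Finset (Fin N) := {j | κ < ‖k j‖}

/-- The indices of the solitons that are faster than `x / t`, when `κ = k₀(x, t)`:
`Δ⁻` if `α < 0`, and `Δ⁺` if `α > 0`. -/
def fastSet (α : ℝ) (k : Fin N → ℂ) (κ : ℝ) : Finset (Fin N) :=
  if α < 0 then deltaMinus k κ else deltaPlus k κ

/-- The part of the real axis on which `δ` jumps: `(-κ, κ)` if `α < 0`, and `{s : |s| > κ}` if
`α > 0`. -/
def jumpSet (α κ : ℝ) : Set ℝ := if α < 0 then {s | |s| < κ} else {s | κ < |s|}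

/-- `ν(s) = -(1 / 2π) log (1 + |r(s)|²)`. -/
def nu (r : ℝ → ℂ) (s : ℝ) : ℝ := -(1 / (2 * Real.pi)) * Real.log (1 + ‖r s‖ ^ 2)

/-- `δ(z) = exp (i ∫ ν(s) / (s - z) ds)`, the integral taken over `jumpSet α κ`. -/
def delta (α : ℝ) (r : ℝ → ℂ) (κ : ℝ) (z : ℂ) : ℂ :=
  Complex.exp (Complex.I * ∫ s in jumpSet α κ, (nu r s : ℂ) / ((s : ℂ) - z))

/-! The cone and the eigenvalues inside it -/

/-- The cone `C(x₁, x₂, v₁, v₂)`. -/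
def cone (x₁ x₂ v₁ v₂ : ℝ) : Set (ℝ × ℝ) :=
  {p | ∃ x₀ ∈ Set.Icc x₁ x₂, ∃ v ∈ Set.Icc v₁ v₂, p.1 = x₀ + v * p.2}

/-- `f(v) = (-α / (4 v))^{1/2}`. -/
def fSpeed (α v : ℝ) : ℝ := √(-α / (4 * v))

/-- The region `𝓘` of all `z` with `|z|` strictly between `f(v₁)` and `f(v₂)`. -/
def annulus (α v₁ v₂ : ℝ) : Set ℂ :=
  {z | min (fSpeed α v₁) (fSpeed α v₂) < ‖z‖ ∧ ‖z‖ < max (fSpeed α v₁) (fSpeed α v₂)}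

open Classical in
/-- The indices of the eigenvalues in `𝓚(𝓘)`. -/
def inside (α v₁ v₂ : ℝ) (k : Fin N → ℂ) : Finset (Fin N) := {j | k j ∈ annulus α v₁ v₂}

/-- The velocity `-α / (4 |z|²)` of the soliton with eigenvalue `z`. -/
def velocity (α : ℝ) (z : ℂ) : ℝ := -α / (4 * ‖z‖ ^ 2)

/-- The numbers `Im k_j · dist(v_{k_j}, [v₁, v₂])` for the eigenvalues outside `𝓘`. -/
def rateSet (α v₁ v₂ : ℝ) (k : Fin N → ℂ) : Set ℝ :=
  {ρ | ∃ j, k j ∉ annulus α v₁ v₂ ∧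
    ρ = (k j).im * Metric.infDist (velocity α (k j)) (Set.Icc v₁ v₂)}

/-! The data `𝓓~` and `𝓓~(𝓘)` -/

/-- The data on the eigenvalues with indices in `S` that are obtained from the norming constants
`c_j`, the numbers `d_j = δ(k_j)` and the set `∇`. -/
def modulatedData (k c d : Fin N → ℂ) (S nabla : Finset (Fin N)) : SolitonData N where
  index := S
  pole := k
  coeff j :=
    if j ∈ nabla then (c j)⁻¹ * (deriv (s11 k nabla) (k j) ^ 2)⁻¹ * d j ^ 2
    else c j * s11 k nabla (k j) ^ 2 * (d j ^ 2)⁻¹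
  nabla := nabla

/-- The data `𝓓~` of the full problem (all eigenvalues), where `κ = k₀` and `∇ = Δ^±`. -/
def fullData (α : ℝ) (r : ℝ → ℂ) (k c : Fin N → ℂ) (κ : ℝ) (nabla : Finset (Fin N)) :
    SolitonData N :=
  modulatedData k c (fun j => delta α r κ (k j)) Finset.univ nabla

/-- `c_j ∏ ((k_j - k_n) / (k_j - k_n^*))²`, over the faster solitons `n` outside `𝓘`. -/
def insideConst (α v₁ v₂ : ℝ) (k c : Fin N → ℂ) (κ : ℝ) (j : Fin N) : ℂ :=
  c j * ∏ n ∈ fastSet α k κ \ inside α v₁ v₂ k, ((k j - k n) / (k j - conj (k n))) ^ 2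

/-- The data `𝓓~(𝓘)`: only the eigenvalues in `𝓚(𝓘)`, with the constants `insideConst`. -/
def insideData (α v₁ v₂ : ℝ) (r : ℝ → ℂ) (k c : Fin N → ℂ) (κ : ℝ) (nabla : Finset (Fin N)) :
    SolitonData N :=
  modulatedData k (insideConst α v₁ v₂ k c κ) (fun j => delta α r κ (k j))
    (inside α v₁ v₂ k) (nabla ∩ inside α v₁ v₂ k)

end ABSystem

end

/-!
Multiplying the columns of a solution `M` of the discrete Riemann-Hilbert problem by Blaschke
products moves all poles to the lower half plane. The result `W` tends to `I`, has simple poles at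
the `k_n^*`, and satisfies `W(k_j) χ_j = 0` for vectors `χ_j` that encode the residue conditions;
the symmetry of the problem makes the residue of `W` at `k_n^*` equal to `-y_n χ_n^†`. The
conditions `W(k_j) χ_j = 0` thus become a linear system for the `y_n` whose matrix
`i ⟨χ_n, χ_j⟩ / (k_j - k_n^*)` is the Hadamard product of a positive definite Cauchy matrix and a
Gram matrix. Hence the problem is uniquely solvable, with bounds uniform in the `χ_j` as long as
these stay away from `0`, and `A_sol` and `B_sol` are rational functions of the `χ_j`.

The choice of `∇` only changes the Blaschke products, not the lines `ℂ χ_j`, so it does not affect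
the soliton solution. The problem for the eigenvalues in `𝓘` is the one for all eigenvalues in
which the `χ_j` with `k_j ∉ 𝓘` are replaced by a basis vector: the first one for the slow solitons,
the second one for the fast ones. In the cone, the normalized `χ_j` of these solitons differ from
the basis vectors by `O(e^{-2μt})`, and so do the solutions of the linear systems.
-/

noncomputable section

namespace ABSystem

/-! Removable singularities -/

theorem isLittleO_sub_of_tendsto_sub_mul {f : ℂ → ℂ} {p : ℂ}
    (hf : Tendsto (fun z => (z - p) * f z) (𝓝[≠] p) (𝓝 0)) :
    (fun z => f z - f p) =o[𝓝[≠] p] fun z => (z - p)⁻¹ := by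
  have hne : ∀ᶠ z in 𝓝[≠] p, (z - p)⁻¹ = 0 → f z - f p = 0 := by
    filter_upwards [self_mem_nhdsWithin] with z hz h
    exact absurd (inv_eq_zero.1 h) (sub_ne_zero.2 hz)
  have hconst : Tendsto (fun z => (z - p) * f p) (𝓝[≠] p) (𝓝 0) := by
    have : ContinuousAt (fun z => (z - p) * f p) p := by fun_prop
    simpa using this.tendsto.mono_left nhdsWithin_le_nhds
  rw [Asymptotics.isLittleO_iff_tendsto' hne]
  refine (sub_zero (0 : ℂ) ▸ hf.sub hconst).congr fun z => ?_
  rw [div_inv_eq_mul]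
  ring

theorem tendsto_div_of_tendsto_sub_mul {f g : ℂ → ℂ} {p a b : ℂ}
    (hf : Tendsto (fun z => (z - p) * f z) (𝓝[≠] p) (𝓝 a))
    (hg : Tendsto (fun z => (z - p) * g z) (𝓝[≠] p) (𝓝 b)) (hb : b ≠ 0) :
    Tendsto (fun z => f z / g z) (𝓝[≠] p) (𝓝 (a / b)) := by
  refine (hf.div hg hb).congr' ?_
  filter_upwards [self_mem_nhdsWithin] with z hz
  exact mul_div_mul_left _ _ (sub_ne_zero.2 hz)

theorem exists_tendsto_of_tendsto_sub_mul {f : ℂ → ℂ} {p : ℂ}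
    (hd : ∀ᶠ z in 𝓝[≠] p, DifferentiableAt ℂ f z)
    (hf : Tendsto (fun z => (z - p) * f z) (𝓝[≠] p) (𝓝 0)) :
    ∃ L, Tendsto f (𝓝[≠] p) (𝓝 L) :=
  ⟨_, Complex.tendsto_limUnder_of_differentiable_on_punctured_nhds_of_isLittleO hd
    (isLittleO_sub_of_tendsto_sub_mul hf)⟩

theorem exists_entire_extension (P : Finset ℂ) (f : ℂ → ℂ)
    (hd : DifferentiableOn ℂ f (P : Set ℂ)ᶜ)
    (hf : ∀ p ∈ P, Tendsto (fun z => (z - p) * f z) (𝓝[≠] p) (𝓝 0)) :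
    ∃ g : ℂ → ℂ, Differentiable ℂ g ∧ ∀ z ∉ P, g z = f z := by
  induction P using Finset.induction_on generalizing f with
  | empty => exact ⟨f, by simpa [differentiableOn_univ] using hd, fun _ _ => rfl⟩
  | insert p P hp ih =>
    have hopen : (P : Set ℂ)ᶜ ∈ 𝓝 p := P.finite_toSet.isClosed.isOpen_compl.mem_nhds (by simpa)
    have hd' : DifferentiableOn ℂ f ((P : Set ℂ)ᶜ \ {p}) :=
      hd.mono fun z hz => by simpa [not_or] using hz.symm
    obtain ⟨g, hg, hgf⟩ := ih _ (Complex.differentiableOn_update_limUnder_of_isLittleO hopen hd'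
      (isLittleO_sub_of_tendsto_sub_mul (hf p (by simp)))) fun q hq => by
        have hqp : q ≠ p := fun h => hp (h ▸ hq)
        refine (hf q (by simp [hq])).congr' ?_
        filter_upwards [nhdsWithin_le_nhds (isOpen_ne.mem_nhds hqp)] with z hz
        rw [Function.update_of_ne hz]
    refine ⟨g, hg, fun z hz => ?_⟩
    simp only [Finset.mem_insert, not_or] at hz
    rw [hgf z hz.2, Function.update_of_ne hz.1]

theorem eq_const_of_tendsto_sub_mul {P : Finset ℂ} {f : ℂ → ℂ} {c : ℂ}
    (hd : DifferentiableOn ℂ f (P : Set ℂ)ᶜ)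
    (hf : ∀ p ∈ P, Tendsto (fun z => (z - p) * f z) (𝓝[≠] p) (𝓝 0))
    (hc : Tendsto f (Bornology.cobounded ℂ) (𝓝 c)) {z : ℂ} (hz : z ∉ P) : f z = c := by
  obtain ⟨g, hg, hgf⟩ := exists_entire_extension P f hd hf
  have hlim : Tendsto g (cocompact ℂ) (𝓝 c) := by
    rw [← Metric.cobounded_eq_cocompact]
    refine hc.congr' ?_
    filter_upwards [Bornology.isBounded_def.1 P.finite_toSet.isBounded] with w hw
    exact (hgf w hw).symm
  rw [← hgf z hz]
  exact hg.apply_eq_of_tendsto_cocompact z hlim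

/-! Cauchy matrices -/

theorem sub_conj_ne_zero {a b : ℂ} (ha : 0 < a.im) (hb : 0 < b.im) : a - conj b ≠ 0 := fun h => by
  have : a.im + b.im = 0 := by simpa using congrArg Complex.im h
  linarith

section Gram

open Matrix

open scoped ComplexOrder MatrixOrder

theorem exists_pos_posSemidef_sub_smul_one {ι : Type*} [Finite ι] [DecidableEq ι]
    {A : Matrix ι ι ℂ} (hA : A.PosDef) :
    ∃ l : ℝ, 0 < l ∧ (A - l • (1 : Matrix ι ι ℂ)).PosSemidef := by
  cases nonempty_fintype ι
  have hsmall : ∀ᶠ l in 𝓝[>] (0 : ℝ), ∀ i, l ≤ hA.isHermitian.eigenvalues i :=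
    eventually_all.2 fun i => mem_of_superset (Ioc_mem_nhdsGT (hA.eigenvalues_pos i)) fun _ h => h.2
  obtain ⟨l, hl, hle⟩ := (eventually_mem_nhdsWithin.and hsmall).exists
  refine ⟨l, hl, ?_⟩
  rw [← Algebra.algebraMap_eq_smul_one, ← Matrix.le_iff]
  refine algebraMap_le_of_le_spectrum (ha := hA.isHermitian) ?_
  rw [hA.isHermitian.spectrum_real_eq_range_eigenvalues]
  exact Set.forall_mem_range.2 hle

variable {ι m : Type*} {k : ι → ℂ} {χ : Matrix ι m ℂ}

/-- The Cauchy matrix `i / (k_j - k_n^*)`. -/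
def cauchyGram (k : ι → ℂ) : Matrix ι ι ℂ :=
  of fun j n => Complex.I / (k j - conj (k n))

theorem cauchyGram_isHermitian (k : ι → ℂ) : (cauchyGram k).IsHermitian := by
  ext j n
  simp only [cauchyGram, conjTranspose_apply, of_apply, RCLike.star_def, map_div₀, map_sub,
    Complex.conj_I, Complex.conj_conj]
  rw [← neg_sub, div_neg, neg_div, neg_neg]

/-- Eigenvalues in the upper half plane that are pairwise distinct. -/
structure IsDiscreteSpectrum (k : ι → ℂ) : Prop where
  injective : Function.Injective k
  im_pos : ∀ j, 0 < (k j).im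

theorem cauchyGram_mulVec_conj_mul [Fintype ι] (hk : ∀ j, 0 < (k j).im) (v : ι → ℂ) :
    cauchyGram k *ᵥ (star k * v) = k * cauchyGram k *ᵥ v - (Complex.I * ∑ n, v n) • 1 := by
  ext j
  simp only [mulVec, dotProduct, Pi.mul_apply, Pi.sub_apply, Pi.star_apply, Pi.smul_apply,
    Pi.one_apply, smul_eq_mul, mul_one, Finset.mul_sum, ← Finset.sum_sub_distrib]
  refine Finset.sum_congr rfl fun n _ => ?_
  have := sub_conj_ne_zero (hk j) (hk n)
  simp only [cauchyGram, of_apply, RCLike.star_def]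
  field_simp
  ring

theorem eigenvalue_mul_sum_im_mul_norm_sq [Fintype ι] (hk : ∀ j, 0 < (k j).im) {v : ι → ℂ} {l : ℝ}
    (hv : cauchyGram k *ᵥ v = (l : ℂ) • v) :
    l * ∑ j, 2 * (k j).im * ‖v j‖ ^ 2 = ‖∑ j, v j‖ ^ 2 := by
  have hv' : star v ᵥ* cauchyGram k = (l : ℂ) • star v := by
    simpa [star_mulVec, (cauchyGram_isHermitian k).eq] using congrArg star hv
  have hdispl := congrArg (star v ⬝ᵥ ·) (cauchyGram_mulVec_conj_mul hk v)
  simp only [dotProduct_mulVec, hv', hv, dotProduct_sub] at hdispl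
  simp only [dotProduct, Pi.smul_apply, Pi.star_apply, Pi.mul_apply, Pi.one_apply, smul_eq_mul,
    mul_one, RCLike.star_def, ← Finset.sum_mul, ← map_sum] at hdispl
  have him : Complex.I * ((l * ∑ j, 2 * (k j).im * ‖v j‖ ^ 2 : ℝ) : ℂ) =
      Complex.I * ((‖∑ j, v j‖ ^ 2 : ℝ) : ℂ) := calc
    _ = ∑ j, (l * k j * (conj (v j) * v j) - l * conj (k j) * (conj (v j) * v j)) := by
      push_cast
      simp only [Finset.mul_sum, Complex.conj_mul', ← sub_mul, ← mul_sub, Complex.sub_conj]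
      refine Finset.sum_congr rfl fun j _ => ?_
      push_cast
      ring
    _ = ∑ j, conj (v j) * (k j * (l * v j)) - ∑ j, l * conj (v j) * (conj (k j) * v j) := by
      rw [← Finset.sum_sub_distrib]
      exact Finset.sum_congr rfl fun j _ => by ring
    _ = _ := by
      rw [hdispl, sub_sub_cancel, Complex.ofReal_pow, ← Complex.conj_mul']
      ring
  exact Complex.ofReal_injective (mul_left_cancel₀ Complex.I_ne_zero him)

theorem eq_zero_of_cauchyGram_mulVec_eq_zero [Fintype ι] (hk : IsDiscreteSpectrum k) {v : ι → ℂ}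
    (hv : cauchyGram k *ᵥ v = 0) : v = 0 := by
  have hsum : ∀ w, cauchyGram k *ᵥ w = 0 → ∑ j, w j = 0 := fun w hw => by
    simpa using (eigenvalue_mul_sum_im_mul_norm_sq hk.im_pos (l := 0) (by simpa using hw)).symm
  have hpow : ∀ d : ℕ, cauchyGram k *ᵥ (star k ^ d * v) = 0 := by
    intro d
    induction d with
    | zero => simpa using hv
    | succ d ih =>
      rw [pow_succ', mul_assoc, cauchyGram_mulVec_conj_mul hk.im_pos, ih, hsum _ ih, mul_zero,
        mul_zero, zero_smul, sub_zero]
  -- A kernel vector is orthogonal to all powers of `k`, so the Vandermonde determinant kills it.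
  let e := Fintype.equivFin ι
  have hvandermonde : v ∘ e.symm = 0 := by
    refine eq_zero_of_forall_pow_sum_mul_pow_eq_zero (f := star k ∘ e.symm)
      ((star_injective.comp hk.injective).comp e.symm.injective) fun d => ?_
    rw [← hsum _ (hpow d), ← e.symm.sum_comp]
    exact Finset.sum_congr rfl fun j _ => mul_comm _ _
  exact funext fun j => by simpa using congrFun hvandermonde (e j)

theorem cauchyGram_posDef [Finite ι] (hk : IsDiscreteSpectrum k) : (cauchyGram k).PosDef := by
  classical
  cases nonempty_fintype ι
  have hH := cauchyGram_isHermitian k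
  refine hH.posDef_iff_eigenvalues_pos.2 fun i => ?_
  set v : ι → ℂ := ⇑(hH.eigenvectorBasis i)
  have hv : cauchyGram k *ᵥ v = (hH.eigenvalues i : ℂ) • v := hH.mulVec_eigenvectorBasis i
  have hv0 : v ≠ 0 := fun h => hH.eigenvectorBasis.orthonormal.ne_zero i (PiLp.ext (congrFun h))
  have hpos : 0 < ∑ j, 2 * (k j).im * ‖v j‖ ^ 2 := by
    obtain ⟨j, hj⟩ := Function.ne_iff.1 hv0
    have him := hk.im_pos
    exact Finset.sum_pos' (fun n _ => mul_nonneg (mul_nonneg zero_le_two (him n).le) (sq_nonneg _))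
      ⟨j, Finset.mem_univ j, mul_pos (mul_pos two_pos (him j)) (pow_pos (norm_pos_iff.2 hj) 2)⟩
  have hnonneg : 0 ≤ hH.eigenvalues i :=
    nonneg_of_mul_nonneg_left (eigenvalue_mul_sum_im_mul_norm_sq hk.im_pos hv ▸ sq_nonneg _) hpos
  refine hnonneg.lt_of_ne fun h => hv0 (eq_zero_of_cauchyGram_mulVec_eq_zero hk ?_)
  simp [hv, ← h]

/-- The matrix `i ⟨χ_n, χ_j⟩ / (k_j - k_n^*)`, where `χ_j` is the `j`-th row of `χ`. It is the
matrix of the linear system to which the discrete Riemann-Hilbert problem reduces. -/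
def gram [Fintype m] (k : ι → ℂ) (χ : Matrix ι m ℂ) : Matrix ι ι ℂ :=
  cauchyGram k ⊙ (χ * χᴴ)

theorem exists_gram_coercive [Fintype ι] [Fintype m] (hk : IsDiscreteSpectrum k) :
    ∃ l : ℝ, 0 < l ∧ ∀ (χ : Matrix ι m ℂ) (v : ι → ℂ),
      l * ∑ j, (∑ c, ‖χ j c‖ ^ 2) * ‖v j‖ ^ 2 ≤ (star v ⬝ᵥ gram k χ *ᵥ v).re := by
  classical
  obtain ⟨l, hl, h⟩ := exists_pos_posSemidef_sub_smul_one (cauchyGram_posDef hk)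
  refine ⟨l, hl, fun χ v => ?_⟩
  have hsplit : (cauchyGram k - l • (1 : Matrix ι ι ℂ)) ⊙ (χ * χᴴ) =
      gram k χ - diagonal fun j => ((l * ∑ c, ‖χ j c‖ ^ 2 : ℝ) : ℂ) := by
    ext j n
    rcases eq_or_ne j n with rfl | hjn
    · simp [gram, mul_apply, sub_mul, Complex.mul_conj']
    · simp [gram, hjn]
  have hpsd := (h.hadamard (posSemidef_self_mul_conjTranspose χ)).re_dotProduct_nonneg v
  rw [hsplit, sub_mulVec, dotProduct_sub, map_sub, sub_nonneg] at hpsd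
  refine le_of_eq_of_le ?_ hpsd
  have hdiag : star v ⬝ᵥ (diagonal fun j => ((l * ∑ c, ‖χ j c‖ ^ 2 : ℝ) : ℂ)) *ᵥ v =
      ((l * ∑ j, (∑ c, ‖χ j c‖ ^ 2) * ‖v j‖ ^ 2 : ℝ) : ℂ) := by
    simp only [dotProduct, mulVec_diagonal, Pi.star_apply, RCLike.star_def, mul_left_comm,
      Complex.conj_mul']
    push_cast
    simp only [← Finset.mul_sum, mul_assoc]
  exact (congrArg Complex.re hdiag).symm

theorem gram_det_ne_zero [Fintype ι] [DecidableEq ι] [Fintype m] (hk : IsDiscreteSpectrum k)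
    (hχ : ∀ j, χ j ≠ 0) : (gram k χ).det ≠ 0 := by
  obtain ⟨l, hl, h⟩ := exists_gram_coercive (m := m) hk
  intro hdet
  obtain ⟨v, hv0, hv⟩ := exists_mulVec_eq_zero_iff.2 hdet
  obtain ⟨j, hj⟩ := Function.ne_iff.1 hv0
  obtain ⟨c, hc⟩ := Function.ne_iff.1 (hχ j)
  have hχj : 0 < ∑ c, ‖χ j c‖ ^ 2 :=
    Finset.sum_pos' (fun _ _ => by positivity) ⟨c, Finset.mem_univ c, pow_pos (norm_pos_iff.2 hc) 2⟩
  have hpos : 0 < ∑ j, (∑ c, ‖χ j c‖ ^ 2) * ‖v j‖ ^ 2 :=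
    Finset.sum_pos' (fun _ _ => by positivity) ⟨j, Finset.mem_univ j,
      mul_pos hχj (pow_pos (norm_pos_iff.2 hj) 2)⟩
  have hle := h χ v
  rw [hv, dotProduct_zero, Complex.zero_re] at hle
  exact (mul_pos hl hpos).not_ge hle

end Gram

/-! Blaschke products -/

theorem tendsto_sub_nhdsNE (p : ℂ) : Tendsto (fun z => z - p) (𝓝[≠] p) (𝓝 0) :=
  ((continuous_sub_right p).tendsto' p 0 (sub_self p)).mono_left nhdsWithin_le_nhds

theorem tendsto_conj_nhdsNE (p : ℂ) : Tendsto conj (𝓝[≠] conj p) (𝓝[≠] p) := by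
  refine tendsto_nhdsWithin_iff.2
    ⟨(Complex.continuous_conj.tendsto' _ _ (Complex.conj_conj p)).mono_left nhdsWithin_le_nhds, ?_⟩
  filter_upwards [self_mem_nhdsWithin] with z hz h
  exact hz ((star_eq_iff_star_eq.1 h).symm)

theorem tendsto_conj_comp_conj {f : ℂ → ℂ} {p L : ℂ}
    (h : Tendsto f (𝓝[≠] p) (𝓝 L)) :
    Tendsto (fun z => conj (f (conj z))) (𝓝[≠] conj p) (𝓝 (conj L)) :=
  (Complex.continuous_conj.tendsto _).comp (h.comp (tendsto_conj_nhdsNE p))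

theorem isBigO_div_sub (a p : ℂ) :
    (fun z => a / (z - p)) =O[Bornology.cobounded ℂ] fun z => z⁻¹ := by
  have hconst : (fun _ : ℂ => p) =o[Bornology.cobounded ℂ] fun z : ℂ => z :=
    Asymptotics.isLittleO_const_left.2 (Or.inr tendsto_norm_cobounded_atTop)
  have hsub : (fun z : ℂ => z) =O[Bornology.cobounded ℂ] fun z => z - p :=
    (Asymptotics.IsEquivalent.refl.sub_isLittleO hconst).isBigO_symm
  have hinv := hsub.inv_rev <| by
    filter_upwards [Bornology.eventually_ne_cobounded (0 : ℂ)] with z hz h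
    exact absurd h hz
  simpa only [div_eq_mul_inv] using hinv.const_mul_left a

theorem tendsto_of_isBigO_inv {f : ℂ → ℂ} {c : ℂ}
    (h : (fun z => f z - c) =O[Bornology.cobounded ℂ] fun z => z⁻¹) :
    Tendsto f (Bornology.cobounded ℂ) (𝓝 c) := by
  simpa using (h.trans_tendsto tendsto_inv₀_cobounded).add_const c

theorem isBigO_mul_sub {f g : ℂ → ℂ} {c : ℂ}
    (hf : (fun z => f z - c) =O[Bornology.cobounded ℂ] fun z => z⁻¹)
    (hg : (fun z => g z - 1) =O[Bornology.cobounded ℂ] fun z => z⁻¹) :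
    (fun z => f z * g z - c) =O[Bornology.cobounded ℂ] fun z => z⁻¹ := by
  have h := hf.mul ((tendsto_of_isBigO_inv hg).isBigO_one ℂ)
  simp only [mul_one] at h
  exact (h.add (hg.const_mul_left c)).congr_left fun z => by ring

variable {N : ℕ} {k : Fin N → ℂ} {A B : Finset (Fin N)} {j : Fin N}

/-- The derivative of `s11 k A` at its zero `k j`. -/
def s11Deriv (k : Fin N → ℂ) (A : Finset (Fin N)) (j : Fin N) : ℂ :=
  s11 k (A.erase j) (k j) / (k j - conj (k j))

theorem s11_ne_zero {z : ℂ} (h : ∀ n ∈ A, z ≠ k n) (h' : ∀ n ∈ A, z ≠ conj (k n)) :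
    s11 k A z ≠ 0 :=
  Finset.prod_ne_zero_iff.2 fun n hn =>
    div_ne_zero (sub_ne_zero.2 (h n hn)) (sub_ne_zero.2 (h' n hn))

theorem ne_conj_of_im_pos {a b : ℂ} (ha : 0 < a.im) (hb : 0 < b.im) : a ≠ conj b :=
  sub_ne_zero.1 (sub_conj_ne_zero ha hb)

theorem s11_pole_ne_zero (hk : IsDiscreteSpectrum k) (hj : j ∉ A) : s11 k A (k j) ≠ 0 :=
  s11_ne_zero (fun _ hn h => hj (hk.injective h ▸ hn))
    fun n _ => ne_conj_of_im_pos (hk.im_pos j) (hk.im_pos n)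

theorem s11Deriv_ne_zero (hk : IsDiscreteSpectrum k) (A : Finset (Fin N)) (j : Fin N) :
    s11Deriv k A j ≠ 0 :=
  div_ne_zero (s11_pole_ne_zero hk (Finset.notMem_erase j A))
    (sub_conj_ne_zero (hk.im_pos j) (hk.im_pos j))

theorem s11_conj (k : Fin N → ℂ) (A : Finset (Fin N)) (z : ℂ) :
    s11 k A (conj z) = (conj (s11 k A z))⁻¹ := by
  simp [s11, map_prod]

theorem differentiableAt_s11 {z : ℂ} (h : ∀ n ∈ A, z ≠ conj (k n)) :
    DifferentiableAt ℂ (s11 k A) z :=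
  DifferentiableAt.fun_finsetProd fun n hn => by
    have := sub_ne_zero.2 (h n hn)
    fun_prop (disch := assumption)

theorem s11_eq_mul_erase (hj : j ∈ A) (z : ℂ) :
    s11 k A z = (z - k j) / (z - conj (k j)) * s11 k (A.erase j) z :=
  (Finset.mul_prod_erase A _ hj).symm

theorem s11_union (h : Disjoint A B) (z : ℂ) : s11 k (A ∪ B) z = s11 k A z * s11 k B z :=
  Finset.prod_union h

theorem s11Deriv_union (h : Disjoint A B) (hj : j ∈ A) :
    s11Deriv k (A ∪ B) j = s11Deriv k A j * s11 k B (k j) := by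
  rw [s11Deriv, s11Deriv, Finset.erase_union_distrib,
    Finset.erase_eq_of_notMem (Finset.disjoint_left.1 h hj),
    s11_union (h.mono_left (Finset.erase_subset _ _)), div_mul_eq_mul_div]

theorem hasDerivAt_s11 (hk : ∀ j, 0 < (k j).im) (hj : j ∈ A) :
    HasDerivAt (s11 k A) (s11Deriv k A j) (k j) := by
  have hne : ∀ n, k j ≠ conj (k n) := fun n => ne_conj_of_im_pos (hk j) (hk n)
  have hfactor : DifferentiableAt ℂ (fun z => s11 k (A.erase j) z / (z - conj (k j))) (k j) :=
    (differentiableAt_s11 fun n _ => hne n).fun_div (by fun_prop) (sub_ne_zero.2 (hne j))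
  have hprod := ((hasDerivAt_id (k j)).sub_const (k j)).fun_mul hfactor.hasDerivAt
  simp only [id_eq, sub_self, zero_mul, add_zero, one_mul] at hprod
  refine hprod.congr_of_eventuallyEq (Eventually.of_forall fun z => ?_)
  rw [s11_eq_mul_erase hj, div_mul_eq_mul_div, mul_div_assoc]

theorem tendsto_s11_div_sub (hk : ∀ j, 0 < (k j).im) (hj : j ∈ A) :
    Tendsto (fun z => s11 k A z / (z - k j)) (𝓝[≠] k j) (𝓝 (s11Deriv k A j)) := by
  refine (hasDerivAt_s11 hk hj).tendsto_slope.congr fun z => ?_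
  rw [slope_def_field, s11_eq_mul_erase hj (k j), sub_self, zero_div, zero_mul, sub_zero]

theorem tendsto_s11_pole (hk : ∀ j, 0 < (k j).im) (A : Finset (Fin N)) (j : Fin N) :
    Tendsto (s11 k A) (𝓝[≠] k j) (𝓝 (s11 k A (k j))) :=
  (differentiableAt_s11 fun n _ => ne_conj_of_im_pos (hk j) (hk n)).continuousAt.tendsto.mono_left
    nhdsWithin_le_nhds

theorem tendsto_sub_mul_s11_conj (hk : IsDiscreteSpectrum k) (hj : j ∈ A) :
    Tendsto (fun z => (z - conj (k j)) * s11 k A z) (𝓝[≠] conj (k j))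
      (𝓝 (conj (s11Deriv k A j))⁻¹) := by
  refine ((tendsto_conj_comp_conj (tendsto_s11_div_sub hk.im_pos hj)).inv₀
    ((map_ne_zero _).2 (s11Deriv_ne_zero hk A j))).congr fun z => ?_
  rw [map_div₀, s11_conj, map_inv₀, map_sub, Complex.conj_conj, Complex.conj_conj, inv_div,
    div_inv_eq_mul]

theorem tendsto_s11_conj (hk : IsDiscreteSpectrum k) (hj : j ∉ A) :
    Tendsto (s11 k A) (𝓝[≠] conj (k j)) (𝓝 (conj (s11 k A (k j)))⁻¹) := by
  refine ((tendsto_conj_comp_conj (tendsto_s11_pole hk.im_pos A j)).inv₀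
    ((map_ne_zero _).2 (s11_pole_ne_zero hk hj))).congr fun z => ?_
  rw [s11_conj, map_inv₀, Complex.conj_conj, inv_inv]

theorem isBigO_s11_sub_one (k : Fin N → ℂ) (A : Finset (Fin N)) :
    (fun z => s11 k A z - 1) =O[Bornology.cobounded ℂ] fun z => z⁻¹ := by
  unfold s11
  induction A using Finset.induction_on with
  | empty => simpa using Asymptotics.isBigO_zero _ _
  | insert n A hn ih =>
    simp_rw [Finset.prod_insert hn]
    refine isBigO_mul_sub ((isBigO_div_sub (conj (k n) - k n) (conj (k n))).congr' ?_ .rfl) ih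
    filter_upwards [Bornology.eventually_ne_cobounded (conj (k n))] with z hz
    rw [div_sub_one (sub_ne_zero.2 hz), sub_sub_sub_cancel_left]

theorem tendsto_s11_cobounded (k : Fin N → ℂ) (A : Finset (Fin N)) :
    Tendsto (s11 k A) (Bornology.cobounded ℂ) (𝓝 1) :=
  tendsto_of_isBigO_inv (isBigO_s11_sub_one k A)

theorem isBigO_inv_s11_sub_one (k : Fin N → ℂ) (A : Finset (Fin N)) :
    (fun z => (s11 k A z)⁻¹ - 1) =O[Bornology.cobounded ℂ] fun z => z⁻¹ := by
  have hlim := tendsto_s11_cobounded k A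
  have h := ((hlim.inv₀ one_ne_zero).neg.isBigO_one ℂ).mul (isBigO_s11_sub_one k A)
  simp only [one_mul] at h
  refine h.congr' ?_ .rfl
  filter_upwards [hlim.eventually_ne one_ne_zero] with z hz
  field_simp
  ring

/-! The linear system -/

section LinearSystem

open Matrix

variable {ι m : Type*} {k : ι → ℂ} {S : Finset ι} {χ y y' : Matrix ι m ℂ}

section Gram

variable [Fintype m]

/-- The rows `y_n`, `n ∈ S`, solve the linear system to which the problem with the eigenvalues
`k_n`, `n ∈ S`, reduces. -/
def SolvesGram (k : ι → ℂ) (S : Finset ι) (χ y : Matrix ι m ℂ) : Prop :=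
  ∀ j ∈ S, ∑ n ∈ S, gram k χ j n • y n = Complex.I • χ j

theorem solvesGram_iff_submatrix :
    SolvesGram k S χ y ↔
      gram (fun n : S => k n) (χ.submatrix (Subtype.val : S → ι) id) *
          y.submatrix (Subtype.val : S → ι) id =
        Complex.I • χ.submatrix (Subtype.val : S → ι) id := by
  refine ⟨fun h => ?_, fun h j hj => ?_⟩
  · ext j i
    rw [mul_apply]
    exact (S.sum_coe_sort fun n => gram k χ j n * y n i).trans <| by
      simpa using congrFun (h j j.2) i
  · ext i
    have hji := congrFun (congrFun h ⟨j, hj⟩) i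
    rw [mul_apply] at hji
    simpa using (S.sum_coe_sort fun n => gram k χ j n * y n i).symm.trans hji

theorem isUnit_det_gram_submatrix [DecidableEq ι] (hk : IsDiscreteSpectrum k)
    (hχ : ∀ j ∈ S, χ j ≠ 0) :
    IsUnit (gram (fun n : S => k n) (χ.submatrix (Subtype.val : S → ι) id)).det :=
  isUnit_iff_ne_zero.2 <| gram_det_ne_zero
    ⟨hk.injective.comp Subtype.val_injective, fun j => hk.im_pos j⟩ fun j => hχ j j.2

theorem exists_solvesGram (hk : IsDiscreteSpectrum k) (hχ : ∀ j ∈ S, χ j ≠ 0) :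
    ∃ y, SolvesGram k S χ y := by
  classical
  let χS := χ.submatrix (Subtype.val : S → ι) id
  let yS : Matrix S m ℂ := Complex.I • ((gram (fun n : S => k n) χS)⁻¹ * χS)
  let y : Matrix ι m ℂ := fun n => if hn : n ∈ S then yS ⟨n, hn⟩ else 0
  have hy : y.submatrix (Subtype.val : S → ι) id = yS := by
    ext n i
    exact congrFun (dif_pos n.2) i
  refine ⟨y, solvesGram_iff_submatrix.2 ?_⟩
  rw [hy, Matrix.mul_smul, mul_nonsing_inv_cancel_left _ _ (isUnit_det_gram_submatrix hk hχ)]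

theorem SolvesGram.eq_of_mem (hk : IsDiscreteSpectrum k) (hχ : ∀ j ∈ S, χ j ≠ 0)
    (hy : SolvesGram k S χ y) (hy' : SolvesGram k S χ y') {n : ι} (hn : n ∈ S) : y n = y' n := by
  classical
  have h := (solvesGram_iff_submatrix.1 hy).trans (solvesGram_iff_submatrix.1 hy').symm
  let := invertibleOfIsUnitDet _ (isUnit_det_gram_submatrix hk hχ)
  exact congrFun (mul_right_injective_of_invertible _ h) ⟨n, hn⟩

theorem solvesGram_univ [Fintype ι] [DecidableEq ι] (hk : IsDiscreteSpectrum k)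
    (hχ : ∀ j, χ j ≠ 0) : SolvesGram k Finset.univ χ (Complex.I • ((gram k χ)⁻¹ * χ)) := by
  have h : gram k χ * (Complex.I • ((gram k χ)⁻¹ * χ)) = Complex.I • χ := by
    rw [Matrix.mul_smul,
      mul_nonsing_inv_cancel_left _ _ (isUnit_iff_ne_zero.2 (gram_det_ne_zero hk hχ))]
  intro j _
  ext i
  simpa [mul_apply] using congrFun (congrFun h j) i

end Gram

/-- The matrix function `I - ∑ y_n χ_n^† / (z - k_n^*)` with simple poles in the lower half
plane. -/
def dressedMatrix [DecidableEq m] (k : ι → ℂ) (S : Finset ι) (χ y : Matrix ι m ℂ) (z : ℂ) :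
    Matrix m m ℂ :=
  1 - ∑ n ∈ S, (z - conj (k n))⁻¹ • vecMulVec (y n) (star (χ n))

variable [DecidableEq m]

theorem dressedMatrix_apply (k : ι → ℂ) (S : Finset ι) (χ y : Matrix ι m ℂ) (z : ℂ) (i c : m) :
    dressedMatrix k S χ y z i c =
      (1 : Matrix m m ℂ) i c - ∑ n ∈ S, y n i * conj (χ n c) / (z - conj (k n)) := by
  simp [dressedMatrix, Matrix.sub_apply, Matrix.sum_apply, vecMulVec_apply, div_eq_inv_mul]

theorem dressedMatrix_mulVec [Fintype m] (k : ι → ℂ) (S : Finset ι) (χ y : Matrix ι m ℂ) (j : ι) :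
    dressedMatrix k S χ y (k j) *ᵥ χ j = χ j + Complex.I • ∑ n ∈ S, gram k χ j n • y n := by
  rw [dressedMatrix, sub_mulVec, one_mulVec, sum_mulVec, sub_eq_add_neg, ← Finset.sum_neg_distrib,
    Finset.smul_sum]
  congr 1
  refine Finset.sum_congr rfl fun n _ => ?_
  have hgram : gram k χ j n = Complex.I * (k j - conj (k n))⁻¹ * (star (χ n) ⬝ᵥ χ j) := by
    rw [dotProduct_comm]
    rfl
  rw [smul_mulVec, vecMulVec_mulVec, hgram, smul_smul]
  ext i
  simp only [Pi.neg_apply, Pi.smul_apply, smul_eq_mul, MulOpposite.smul_eq_mul_unop,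
    MulOpposite.unop_op]
  linear_combination (-((k j - conj (k n))⁻¹ * (star (χ n) ⬝ᵥ χ j) * y n i)) * Complex.I_mul_I

theorem dressedMatrix_mulVec_eq_zero_iff [Fintype m] {j : ι} :
    dressedMatrix k S χ y (k j) *ᵥ χ j = 0 ↔ ∑ n ∈ S, gram k χ j n • y n = Complex.I • χ j := by
  have hfactor : χ j + Complex.I • ∑ n ∈ S, gram k χ j n • y n =
      Complex.I • (∑ n ∈ S, gram k χ j n • y n - Complex.I • χ j) := by
    rw [smul_sub, smul_smul, Complex.I_mul_I, neg_one_smul, sub_neg_eq_add, add_comm]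
  rw [dressedMatrix_mulVec, hfactor, smul_eq_zero_iff_right Complex.I_ne_zero, sub_eq_zero]

theorem differentiableAt_dressedMatrix (χ y : Matrix ι m ℂ) {z : ℂ} (hz : ∀ n ∈ S, z ≠ conj (k n))
    (i c : m) : DifferentiableAt ℂ (fun z => dressedMatrix k S χ y z i c) z := by
  simp only [dressedMatrix_apply]
  refine (differentiableAt_const _).fun_sub (DifferentiableAt.fun_sum fun n hn => ?_)
  have := sub_ne_zero.2 (hz n hn)
  fun_prop (disch := assumption)

theorem tendsto_dressedMatrix (χ y : Matrix ι m ℂ) (hk : ∀ j, 0 < (k j).im) (j : ι) (i c : m) :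
    Tendsto (fun z => dressedMatrix k S χ y z i c) (𝓝[≠] k j)
      (𝓝 (dressedMatrix k S χ y (k j) i c)) :=
  (differentiableAt_dressedMatrix χ y (fun n _ => sub_ne_zero.1 (sub_conj_ne_zero (hk j) (hk n)))
    i c).continuousAt.tendsto.mono_left nhdsWithin_le_nhds

theorem tendsto_sub_mul_div_sub [DecidableEq ℂ] (a p q : ℂ) :
    Tendsto (fun z => (z - p) * (a / (z - q))) (𝓝[≠] p) (𝓝 (if q = p then a else 0)) := by
  split_ifs with h
  · subst h
    refine tendsto_const_nhds.congr' ?_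
    filter_upwards [self_mem_nhdsWithin] with z hz
    rw [mul_div_cancel₀ _ (sub_ne_zero.2 hz)]
  · have : ContinuousAt (fun z => (z - p) * (a / (z - q))) p := by
      have : p - q ≠ 0 := sub_ne_zero.2 (Ne.symm h)
      fun_prop (disch := assumption)
    simpa using this.tendsto.mono_left nhdsWithin_le_nhds

theorem tendsto_sub_mul_dressedMatrix (hk : Function.Injective k) (χ y : Matrix ι m ℂ) {j : ι}
    (hj : j ∈ S) (i c : m) :
    Tendsto (fun z => (z - conj (k j)) * dressedMatrix k S χ y z i c) (𝓝[≠] conj (k j))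
      (𝓝 (-(y j i * conj (χ j c)))) := by
  classical
  have hconst := (tendsto_sub_nhdsNE (conj (k j))).mul_const ((1 : Matrix m m ℂ) i c)
  have hsum := tendsto_finsetSum S fun n _ =>
    tendsto_sub_mul_div_sub (y n i * conj (χ n c)) (conj (k j)) (conj (k n))
  simp only [(starRingEnd ℂ).injective.eq_iff, hk.eq_iff, Finset.sum_ite_eq', hj, if_true] at hsum
  rw [zero_mul] at hconst
  have h := hconst.sub hsum
  rw [zero_sub] at h
  refine h.congr fun z => ?_
  rw [dressedMatrix_apply, mul_sub, Finset.mul_sum]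

theorem isBigO_dressedMatrix (k : ι → ℂ) (S : Finset ι) (χ y : Matrix ι m ℂ) (i c : m) :
    (fun z => dressedMatrix k S χ y z i c - (1 : Matrix m m ℂ) i c)
      =O[Bornology.cobounded ℂ] fun z => z⁻¹ := by
  simp only [dressedMatrix_apply, sub_sub_cancel_left]
  exact (Asymptotics.IsBigO.fun_sum fun n _ => isBigO_div_sub _ _).neg_left

end LinearSystem

/-! Residue conditions -/

theorem eq_or_eq_rev (b c : Fin 2) : b = c ∨ b = c.rev := by decide +revert

theorem rev_ne (c : Fin 2) : c.rev ≠ c := by decide +revert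

theorem sum_eq_add_rev {E : Type*} [AddCommMonoid E] (f : Fin 2 → E) (c : Fin 2) :
    ∑ b, f b = f c + f c.rev := by
  rw [Fin.sum_univ_two]
  fin_cases c
  exacts [rfl, add_comm _ _]

variable {α x t : ℝ} {D : SolitonData N} {M : ℂ → Matrix (Fin 2) (Fin 2) ℂ} {p E z : ℂ} {c : Fin 2}

theorem HasResidueRelation.exists_tendsto
    (hM : ∀ i c, ∀ᶠ z in 𝓝[≠] p, DifferentiableAt ℂ (fun z => M z i c) z)
    (h : HasResidueRelation M p (Matrix.single c.rev c E)) (i : Fin 2) :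
    ∃ L, Tendsto (fun z => M z i c.rev) (𝓝[≠] p) (𝓝 L) ∧
      Tendsto (fun z => (z - p) * M z i c) (𝓝[≠] p) (𝓝 (L * E)) := by
  obtain ⟨R, hres, hlim⟩ := h
  have hres' : ∀ b, Tendsto (fun z => (z - p) * M z i b) (𝓝[≠] p) (𝓝 (R i b)) := fun b =>
    tendsto_pi_nhds.1 (tendsto_pi_nhds.1 hres i) b
  have hlim' : ∀ b, Tendsto (fun z => (M z * Matrix.single c.rev c E) i b) (𝓝[≠] p) (𝓝 (R i b)) :=
    fun b => tendsto_pi_nhds.1 (tendsto_pi_nhds.1 hlim i) b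
  have hrev : R i c.rev = 0 := tendsto_nhds_unique (hlim' c.rev) <| by
    simp only [Matrix.mul_single_apply_of_ne _ _ _ _ _ (rev_ne c), tendsto_const_nhds]
  obtain ⟨L, hL⟩ := exists_tendsto_of_tendsto_sub_mul (hM i c.rev) (hrev ▸ hres' c.rev)
  have hRL : R i c = L * E := tendsto_nhds_unique (hlim' c) <| by
    simpa only [Matrix.mul_single_apply_same] using hL.mul_const E
  exact ⟨L, hL, hRL ▸ hres' c⟩

theorem hasResidueRelation_single
    (h : ∀ i, ∃ L, Tendsto (fun z => M z i c.rev) (𝓝[≠] p) (𝓝 L) ∧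
      Tendsto (fun z => (z - p) * M z i c) (𝓝[≠] p) (𝓝 (L * E))) :
    HasResidueRelation M p (Matrix.single c.rev c E) := by
  choose L hL hres using h
  refine ⟨Matrix.of fun i b => if b = c then L i * E else 0,
    tendsto_pi_nhds.2 fun i => tendsto_pi_nhds.2 fun b => ?_,
    tendsto_pi_nhds.2 fun i => tendsto_pi_nhds.2 fun b => ?_⟩
  · rcases eq_or_eq_rev b c with rfl | rfl
    · simpa using hres i
    · simpa [rev_ne] using (tendsto_sub_nhdsNE p).mul (hL i)
  · rcases eq_or_eq_rev b c with rfl | rfl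
    · simpa using (hL i).mul_const E
    · simp [rev_ne, Matrix.mul_single_apply_of_ne _ _ _ _ _ (rev_ne c)]

/-- The column of the solution that is singular at `k_j`; the other one is singular at `k_j^*`. -/
def SolitonData.singularColumn (D : SolitonData N) (j : Fin N) : Fin 2 :=
  if j ∈ D.nabla then 1 else 0

/-- The nonzero entry of the residue matrix at `k_j`. -/
def SolitonData.entry (D : SolitonData N) (α x t : ℝ) (j : Fin N) : ℂ :=
  D.coeff j * Complex.exp ((if j ∈ D.nabla then -2 else 2) * Complex.I * tTheta α x t (D.pole j))

theorem conj_tTheta (α x t : ℝ) (z : ℂ) : conj (tTheta α x t z) = tTheta α x t (conj z) := by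
  simp [tTheta, map_ofNat]

theorem SolitonData.residueMatrix_eq_single (D : SolitonData N) (α x t : ℝ) (j : Fin N) :
    D.residueMatrix α x t j =
      Matrix.single (D.singularColumn j).rev (D.singularColumn j) (D.entry α x t j) := by
  by_cases h : j ∈ D.nabla <;> ext a b <;> fin_cases a <;> fin_cases b <;>
    simp [residueMatrix, singularColumn, entry, h]

theorem SolitonData.residueMatrixConj_eq_single (D : SolitonData N) (α x t : ℝ) (j : Fin N) :
    D.residueMatrixConj α x t j =
      Matrix.single (D.singularColumn j) (D.singularColumn j).rev (-conj (D.entry α x t j)) := by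
  by_cases h : j ∈ D.nabla <;> ext a b <;> fin_cases a <;> fin_cases b <;>
    simp [residueMatrixConj, singularColumn, entry, h, ← Complex.exp_conj, conj_tTheta, map_ofNat]

theorem SolitonData.finite_poles (D : SolitonData N) : D.poles.Finite := by
  have h : D.poles = ⋃ j ∈ D.index, {D.pole j, conj (D.pole j)} := by
    ext z
    simp [poles]
  rw [h]
  exact D.index.finite_toSet.biUnion fun j _ => Set.toFinite _

theorem SolitonData.isOpen_compl_poles (D : SolitonData N) : IsOpen D.polesᶜ :=
  D.finite_poles.isClosed.isOpen_compl

theorem SolitonData.eventually_notMem_poles (D : SolitonData N) (p : ℂ) :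
    ∀ᶠ z in 𝓝[≠] p, z ∉ D.poles :=
  nhdsNE_le_cofinite p D.finite_poles.compl_mem_cofinite

theorem SolitonData.ne_pole (hz : z ∉ D.poles) {n : Fin N} (hn : n ∈ D.index) : z ≠ D.pole n :=
  fun h => hz ⟨n, hn, Or.inl h⟩

theorem SolitonData.ne_conj_pole (hz : z ∉ D.poles) {n : Fin N} (hn : n ∈ D.index) :
    z ≠ conj (D.pole n) :=
  fun h => hz ⟨n, hn, Or.inr h⟩

theorem SolitonData.conj_notMem_poles (hz : z ∉ D.poles) : conj z ∉ D.poles := by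
  rintro ⟨j, hj, h | h⟩
  · exact D.ne_conj_pole hz hj (star_eq_iff_star_eq.1 h).symm
  · exact D.ne_pole hz hj ((starRingEnd ℂ).injective h)

/-- `M` satisfies all the conditions of the discrete Riemann-Hilbert problem except the symmetry,
and it is only required to converge at infinity. These conditions already determine `M`. -/
structure SolvesWeakRHP (α : ℝ) (D : SolitonData N) (x t : ℝ)
    (M : ℂ → Matrix (Fin 2) (Fin 2) ℂ) : Prop where
  analytic : ∀ a b, DifferentiableOn ℂ (fun z => M z a b) D.polesᶜ
  limit : ∀ a b, Tendsto (fun z => M z a b) (Bornology.cobounded ℂ)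
    (𝓝 ((1 : Matrix (Fin 2) (Fin 2) ℂ) a b))
  residue : ∀ j ∈ D.index, HasResidueRelation M (D.pole j) (D.residueMatrix α x t j)
  residue_conj : ∀ j ∈ D.index,
    HasResidueRelation M (conj (D.pole j)) (D.residueMatrixConj α x t j)

theorem SolvesRHP.weak (h : SolvesRHP α D x t M) : SolvesWeakRHP α D x t M where
  analytic := h.analytic
  limit a b := tendsto_of_isBigO_inv (h.asymptotics a b)
  residue := h.residue
  residue_conj := h.residue_conj

theorem SolvesWeakRHP.eventually_differentiableAt (h : SolvesWeakRHP α D x t M) (p : ℂ)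
    (i c : Fin 2) : ∀ᶠ z in 𝓝[≠] p, DifferentiableAt ℂ (fun z => M z i c) z := by
  filter_upwards [D.eventually_notMem_poles p] with z hz
  exact (h.analytic i c).differentiableAt (D.isOpen_compl_poles.mem_nhds hz)

theorem SolvesWeakRHP.exists_tendsto_pole (h : SolvesWeakRHP α D x t M) {j : Fin N}
    (hj : j ∈ D.index) (i : Fin 2) :
    ∃ L, Tendsto (fun z => M z i (D.singularColumn j).rev) (𝓝[≠] D.pole j) (𝓝 L) ∧
      Tendsto (fun z => (z - D.pole j) * M z i (D.singularColumn j)) (𝓝[≠] D.pole j)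
        (𝓝 (L * D.entry α x t j)) :=
  (D.residueMatrix_eq_single α x t j ▸ h.residue j hj).exists_tendsto
    (h.eventually_differentiableAt _) i

theorem SolvesWeakRHP.exists_tendsto_conj_pole (h : SolvesWeakRHP α D x t M) {j : Fin N}
    (hj : j ∈ D.index) (i : Fin 2) :
    ∃ L, Tendsto (fun z => M z i (D.singularColumn j)) (𝓝[≠] conj (D.pole j)) (𝓝 L) ∧
      Tendsto (fun z => (z - conj (D.pole j)) * M z i (D.singularColumn j).rev)
        (𝓝[≠] conj (D.pole j)) (𝓝 (L * -conj (D.entry α x t j))) := by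
  have hres := h.residue_conj j hj
  rw [D.residueMatrixConj_eq_single] at hres
  generalize D.singularColumn j = c at hres ⊢
  obtain ⟨b, rfl⟩ := Fin.rev_surjective c
  rw [Fin.rev_rev] at hres ⊢
  exact hres.exists_tendsto (h.eventually_differentiableAt _) i

/-! Symmetry -/

/-- The involution `X ↦ σ₀ X^* σ₀⁻¹` of the ring of matrices. -/
def sigma0Conj (X : Matrix (Fin 2) (Fin 2) ℂ) : Matrix (Fin 2) (Fin 2) ℂ :=
  sigma0 * X.map conj * sigma0⁻¹

theorem sigma0_inv : sigma0⁻¹ = !![0, -1; 1, 0] :=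
  Matrix.inv_eq_right_inv (by simp [sigma0, Matrix.one_fin_two])

theorem sigma0Conj_apply (X : Matrix (Fin 2) (Fin 2) ℂ) (i c : Fin 2) :
    sigma0Conj X i c = (if i = c then 1 else -1) * conj (X i.rev c.rev) := by
  rw [sigma0Conj, sigma0_inv]
  fin_cases i <;> fin_cases c <;>
    simp [sigma0, Matrix.mul_apply, Fin.rev, Matrix.vecMul, Matrix.vecHead, Matrix.vecTail]

theorem sigma0Conj_one : sigma0Conj 1 = 1 := by
  ext i c
  rw [sigma0Conj_apply]
  by_cases h : i = c <;> simp [Matrix.one_apply, h]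

theorem sigma0Conj_mul (X Y : Matrix (Fin 2) (Fin 2) ℂ) :
    sigma0Conj (X * Y) = sigma0Conj X * sigma0Conj Y := by
  have h : IsUnit sigma0.det := by simp [sigma0]
  simp only [sigma0Conj, Matrix.map_mul, Matrix.mul_assoc, Matrix.nonsing_inv_mul_cancel_left _ _ h]

theorem sigma0Conj_smul (a : ℂ) (X : Matrix (Fin 2) (Fin 2) ℂ) :
    sigma0Conj (a • X) = conj a • sigma0Conj X := by
  ext i c
  simp [sigma0Conj_apply]

theorem sigma0Conj_sigma0Conj (X : Matrix (Fin 2) (Fin 2) ℂ) : sigma0Conj (sigma0Conj X) = X := by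
  ext i c
  by_cases h : i = c <;> simp [sigma0Conj_apply, h]

theorem continuous_sigma0Conj : Continuous sigma0Conj := by
  refine continuous_matrix fun i c => ?_
  simp only [sigma0Conj_apply]
  exact continuous_const.mul (Complex.continuous_conj.comp (continuous_apply_apply _ _))

theorem SolitonData.sigma0Conj_residueMatrix (D : SolitonData N) (α x t : ℝ) (j : Fin N) :
    sigma0Conj (D.residueMatrix α x t j) = D.residueMatrixConj α x t j := by
  by_cases h : j ∈ D.nabla <;> ext a b <;> fin_cases a <;> fin_cases b <;>
    simp [sigma0Conj_apply, residueMatrix, residueMatrixConj, h, ← Complex.exp_conj, conj_tTheta,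
      map_ofNat]

theorem HasResidueRelation.reflect {Θ : Matrix (Fin 2) (Fin 2) ℂ} (h : HasResidueRelation M p Θ) :
    HasResidueRelation (fun z => sigma0Conj (M (conj z))) (conj p) (sigma0Conj Θ) := by
  obtain ⟨R, hres, hlim⟩ := h
  have hcomp : ∀ {F : ℂ → Matrix (Fin 2) (Fin 2) ℂ}, Tendsto F (𝓝[≠] p) (𝓝 R) →
      Tendsto (fun z => sigma0Conj (F (conj z))) (𝓝[≠] conj p) (𝓝 (sigma0Conj R)) := fun hF =>
    (continuous_sigma0Conj.tendsto R).comp (hF.comp (tendsto_conj_nhdsNE p))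
  refine ⟨sigma0Conj R, (hcomp hres).congr fun z => ?_, (hcomp hlim).congr fun z => ?_⟩
  · rw [sigma0Conj_smul, map_sub, Complex.conj_conj]
  · rw [sigma0Conj_mul]

theorem tendsto_conj_cobounded :
    Tendsto (conj : ℂ → ℂ) (Bornology.cobounded ℂ) (Bornology.cobounded ℂ) := by
  rw [← tendsto_norm_atTop_iff_cobounded]
  simpa using tendsto_norm_cobounded_atTop (E := ℂ)

theorem SolvesWeakRHP.reflect (h : SolvesWeakRHP α D x t M) :
    SolvesWeakRHP α D x t fun z => sigma0Conj (M (conj z)) where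
  analytic i c z hz := by
    have hM : DifferentiableAt ℂ (fun z => M z i.rev c.rev) (conj z) :=
      (h.analytic _ _).differentiableAt (D.isOpen_compl_poles.mem_nhds (D.conj_notMem_poles hz))
    have hconj := hM.conj_conj
    rw [Complex.conj_conj] at hconj
    simp only [sigma0Conj_apply]
    exact (hconj.const_mul _).differentiableWithinAt
  limit i c := by
    have hM : Tendsto M (Bornology.cobounded ℂ) (𝓝 1) :=
      tendsto_pi_nhds.2 fun i => tendsto_pi_nhds.2 fun c => h.limit i c
    have hlim := (continuous_sigma0Conj.tendsto' 1 1 sigma0Conj_one).comp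
      (hM.comp tendsto_conj_cobounded)
    exact tendsto_pi_nhds.1 (tendsto_pi_nhds.1 hlim i) c
  residue j hj := by
    have hres := (h.residue_conj j hj).reflect
    rwa [Complex.conj_conj, ← D.sigma0Conj_residueMatrix, sigma0Conj_sigma0Conj] at hres
  residue_conj j hj := D.sigma0Conj_residueMatrix α x t j ▸ (h.residue j hj).reflect

/-! Unique solvability -/

/-- The indices of the eigenvalues at which the column `c` of the solution is singular. -/
def SolitonData.column (D : SolitonData N) (c : Fin 2) : Finset (Fin N) :=
  {j ∈ D.index | D.singularColumn j = c}

/-- The Blaschke product that moves the poles of the column `c` to the lower half plane. -/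
def SolitonData.weight (D : SolitonData N) (c : Fin 2) : ℂ → ℂ := s11 D.pole (D.column c)

theorem SolitonData.mem_column (hj : j ∈ D.index) : j ∈ D.column (D.singularColumn j) :=
  Finset.mem_filter.2 ⟨hj, rfl⟩

theorem SolitonData.notMem_column_rev (D : SolitonData N) (j : Fin N) :
    j ∉ D.column (D.singularColumn j).rev :=
  fun h => rev_ne _ (Finset.mem_filter.1 h).2.symm

theorem SolitonData.mem_index_of_mem_column (h : j ∈ D.column c) : j ∈ D.index :=
  (Finset.mem_filter.1 h).1

theorem SolitonData.weight_ne_zero (hz : z ∉ D.poles) (c : Fin 2) : D.weight c z ≠ 0 :=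
  s11_ne_zero (fun _ hn => D.ne_pole hz (mem_index_of_mem_column hn))
    fun _ hn => D.ne_conj_pole hz (mem_index_of_mem_column hn)

theorem SolitonData.differentiableAt_weight (hz : z ∉ D.poles) (c : Fin 2) :
    DifferentiableAt ℂ (D.weight c) z :=
  differentiableAt_s11 fun _ hn => D.ne_conj_pole hz (mem_index_of_mem_column hn)

/-- The rows `χ_j`, `j ∈ D.index`, span the kernels of the regularized solution at the `k_j`: the
residue condition at `k_j` says that the columns of the regularized solution satisfy
`W(k_j) χ_j = 0`. -/
def Represents (α : ℝ) (D : SolitonData N) (x t : ℝ) (χ : Matrix (Fin N) (Fin 2) ℂ) : Prop :=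
  ∀ j ∈ D.index, χ j ≠ 0 ∧
    χ j (D.singularColumn j).rev * D.weight (D.singularColumn j).rev (D.pole j) =
      -(D.entry α x t j * s11Deriv D.pole (D.column (D.singularColumn j)) j *
        χ j (D.singularColumn j))

variable {χ y : Matrix (Fin N) (Fin 2) ℂ}

theorem Represents.apply_ne_zero (hD : IsDiscreteSpectrum D.pole) (hχ : Represents α D x t χ)
    (hj : j ∈ D.index) : χ j (D.singularColumn j) ≠ 0 := by
  intro h0
  obtain ⟨hne, hrel⟩ := hχ j hj
  rw [h0, mul_zero, neg_zero] at hrel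
  have hrev := (mul_eq_zero.1 hrel).resolve_right (s11_pole_ne_zero hD (D.notMem_column_rev j))
  refine hne (funext fun b => ?_)
  rcases eq_or_eq_rev b (D.singularColumn j) with rfl | rfl
  exacts [h0, hrev]

theorem exists_represents (hD : IsDiscreteSpectrum D.pole) (α x t : ℝ) :
    ∃ χ, Represents α D x t χ := by
  refine ⟨fun j b => if b = D.singularColumn j then 1 else
    -(D.entry α x t j * s11Deriv D.pole (D.column (D.singularColumn j)) j) /
      D.weight (D.singularColumn j).rev (D.pole j), fun j _ => ⟨fun h => ?_, ?_⟩⟩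
  · simpa using congrFun h (D.singularColumn j)
  · have hw : D.weight (D.singularColumn j).rev (D.pole j) ≠ 0 :=
      s11_pole_ne_zero hD (D.notMem_column_rev j)
    simp only [if_neg (rev_ne _), if_true, mul_one]
    exact div_mul_cancel₀ _ hw

theorem SolvesWeakRHP.exists_tendsto_mul_weight (hD : IsDiscreteSpectrum D.pole)
    (h : SolvesWeakRHP α D x t M) (hχ : Represents α D x t χ) (hj : j ∈ D.index) (i : Fin 2) :
    ∃ L : Fin 2 → ℂ,
      (∀ c, Tendsto (fun z => M z i c * D.weight c z) (𝓝[≠] D.pole j) (𝓝 (L c))) ∧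
      L ⬝ᵥ χ j = 0 := by
  obtain ⟨G, hG, hres⟩ := h.exists_tendsto_pole hj i
  have hrel := (hχ j hj).2
  have hcol := D.mem_column hj
  generalize D.singularColumn j = c at *
  refine ⟨fun b => if b = c then G * D.entry α x t j * s11Deriv D.pole (D.column c) j
    else G * D.weight c.rev (D.pole j), fun b => ?_, ?_⟩
  · rcases eq_or_eq_rev b c with rfl | rfl
    · simp only [if_true]
      refine (hres.mul (tendsto_s11_div_sub hD.im_pos hcol)).congr' ?_
      filter_upwards [self_mem_nhdsWithin] with z hz
      have := sub_ne_zero.2 hz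
      rw [SolitonData.weight]
      field_simp
    · simp only [if_neg (rev_ne c)]
      exact hG.mul (tendsto_s11_pole hD.im_pos _ j)
  · rw [dotProduct, sum_eq_add_rev _ c, if_pos rfl, if_neg (rev_ne c)]
    linear_combination G * hrel

theorem SolvesWeakRHP.exists_tendsto_sub_mul_weight (hD : IsDiscreteSpectrum D.pole)
    (h : SolvesWeakRHP α D x t M) (hχ : Represents α D x t χ) (hj : j ∈ D.index) (i : Fin 2) :
    ∃ w : ℂ, ∀ c, Tendsto (fun z => (z - conj (D.pole j)) * (M z i c * D.weight c z))
      (𝓝[≠] conj (D.pole j)) (𝓝 (-(w * conj (χ j c)))) := by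
  obtain ⟨F, hF, hres⟩ := h.exists_tendsto_conj_pole hj i
  have hrel := congrArg conj (hχ j hj).2
  have hχc : conj (χ j (D.singularColumn j)) ≠ 0 := (map_ne_zero _).2 (hχ.apply_ne_zero hD hj)
  have hcol := D.mem_column hj
  have hcol' := D.notMem_column_rev j
  generalize D.singularColumn j = c at *
  have hd : conj (s11Deriv D.pole (D.column c) j) ≠ 0 :=
    (map_ne_zero _).2 (s11Deriv_ne_zero hD (D.column c) j)
  have hw : conj (D.weight c.rev (D.pole j)) ≠ 0 := (map_ne_zero _).2 (s11_pole_ne_zero hD hcol')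
  simp only [map_mul, map_neg] at hrel
  refine ⟨-(F * (conj (s11Deriv D.pole (D.column c) j))⁻¹) / conj (χ j c), fun b => ?_⟩
  rcases eq_or_eq_rev b c with rfl | rfl
  · have hlim : -(-(F * (conj (s11Deriv D.pole (D.column b) j))⁻¹) / conj (χ j b) *
        conj (χ j b)) = F * (conj (s11Deriv D.pole (D.column b) j))⁻¹ := by
      field_simp
    rw [hlim]
    exact (hF.mul (tendsto_sub_mul_s11_conj hD hcol)).congr fun z => mul_left_comm _ _ _
  · have hlim : -(-(F * (conj (s11Deriv D.pole (D.column c) j))⁻¹) / conj (χ j c) *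
        conj (χ j c.rev)) = F * -conj (D.entry α x t j) *
          (conj (D.weight c.rev (D.pole j)))⁻¹ := by
      field_simp
      linear_combination F * hrel
    rw [hlim]
    exact (hres.mul (tendsto_s11_conj hD hcol')).congr fun z => mul_assoc _ _ _

theorem SolvesWeakRHP.exists_residues (hD : IsDiscreteSpectrum D.pole)
    (h : SolvesWeakRHP α D x t M) (hχ : Represents α D x t χ) :
    ∃ y : Matrix (Fin N) (Fin 2) ℂ, ∀ j ∈ D.index, ∀ i c,
      Tendsto (fun z => (z - conj (D.pole j)) * (M z i c * D.weight c z))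
        (𝓝[≠] conj (D.pole j)) (𝓝 (-(y j i * conj (χ j c)))) := by
  have hw : ∀ j i, ∃ w : ℂ, j ∈ D.index → ∀ c,
      Tendsto (fun z => (z - conj (D.pole j)) * (M z i c * D.weight c z))
        (𝓝[≠] conj (D.pole j)) (𝓝 (-(w * conj (χ j c)))) := fun j i => by
    by_cases hj : j ∈ D.index
    · obtain ⟨w, hw⟩ := h.exists_tendsto_sub_mul_weight hD hχ hj i
      exact ⟨w, fun _ => hw⟩
    · exact ⟨0, fun hj' => absurd hj' hj⟩
  choose y hy using hw
  exact ⟨y, fun j hj i => hy j i hj⟩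

theorem SolvesWeakRHP.mul_weight_eq (hD : IsDiscreteSpectrum D.pole) (h : SolvesWeakRHP α D x t M)
    (hχ : Represents α D x t χ) (hy : ∀ j ∈ D.index, ∀ i c,
      Tendsto (fun z => (z - conj (D.pole j)) * (M z i c * D.weight c z))
        (𝓝[≠] conj (D.pole j)) (𝓝 (-(y j i * conj (χ j c)))))
    (hz : z ∉ D.poles) (i c : Fin 2) :
    M z i c * D.weight c z = dressedMatrix D.pole D.index χ y z i c := by
  let f z := M z i c * D.weight c z - dressedMatrix D.pole D.index χ y z i c
  have hanalytic : DifferentiableOn ℂ f (D.finite_poles.toFinset : Set ℂ)ᶜ := by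
    rw [Set.Finite.coe_toFinset]
    refine ((h.analytic i c).fun_mul fun w hw => ?_).fun_sub fun w hw => ?_
    · exact (D.differentiableAt_weight hw c).differentiableWithinAt
    · exact (differentiableAt_dressedMatrix χ y (fun _ hn => D.ne_conj_pole hw hn)
        i c).differentiableWithinAt
  have hremovable : ∀ p ∈ D.finite_poles.toFinset,
      Tendsto (fun z => (z - p) * f z) (𝓝[≠] p) (𝓝 0) := by
    intro p hp
    obtain ⟨j, hj, rfl | rfl⟩ := D.finite_poles.mem_toFinset.1 hp
    · obtain ⟨L, hL, -⟩ := h.exists_tendsto_mul_weight hD hχ hj i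
      simpa only [zero_mul] using (tendsto_sub_nhdsNE (D.pole j)).mul
        ((hL c).sub (tendsto_dressedMatrix χ y hD.im_pos j i c))
    · simpa only [sub_self, ← mul_sub] using
        (hy j hj i c).sub (tendsto_sub_mul_dressedMatrix hD.injective χ y hj i c)
  have hlim : Tendsto f (Bornology.cobounded ℂ) (𝓝 0) := by
    have hdiff := ((h.limit i c).mul (tendsto_s11_cobounded D.pole (D.column c))).sub
      (tendsto_of_isBigO_inv (isBigO_dressedMatrix D.pole D.index χ y i c))
    rwa [mul_one, sub_self] at hdiff
  exact sub_eq_zero.1 (eq_const_of_tendsto_sub_mul hanalytic hremovable hlim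
    fun hz' => hz (D.finite_poles.mem_toFinset.1 hz'))

theorem SolvesWeakRHP.solvesGram (hD : IsDiscreteSpectrum D.pole) (h : SolvesWeakRHP α D x t M)
    (hχ : Represents α D x t χ)
    (hM : ∀ z ∉ D.poles, ∀ i c, M z i c * D.weight c z =
      dressedMatrix D.pole D.index χ y z i c) : SolvesGram D.pole D.index χ y := by
  intro j hj
  refine dressedMatrix_mulVec_eq_zero_iff.1 (funext fun i => ?_)
  obtain ⟨L, hL, hL0⟩ := h.exists_tendsto_mul_weight hD hχ hj i
  have hrow : L = dressedMatrix D.pole D.index χ y (D.pole j) i := by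
    ext c
    refine tendsto_nhds_unique (hL c) ((tendsto_dressedMatrix χ y hD.im_pos j i c).congr' ?_)
    filter_upwards [D.eventually_notMem_poles (D.pole j)] with z hz
    exact (hM z hz i c).symm
  rwa [hrow] at hL0

/-- The solution of the Riemann-Hilbert problem in terms of the solution `y` of the linear
system. -/
def dressed (D : SolitonData N) (χ y : Matrix (Fin N) (Fin 2) ℂ) (z : ℂ) :
    Matrix (Fin 2) (Fin 2) ℂ :=
  Matrix.of fun i c => dressedMatrix D.pole D.index χ y z i c / D.weight c z

theorem SolvesWeakRHP.eq_dressed (hD : IsDiscreteSpectrum D.pole) (h : SolvesWeakRHP α D x t M)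
    (hχ : Represents α D x t χ) (hy : SolvesGram D.pole D.index χ y) (hz : z ∉ D.poles) :
    M z = dressed D χ y z := by
  obtain ⟨y', hy'⟩ := h.exists_residues hD hχ
  have hM : ∀ z ∉ D.poles, ∀ i c, M z i c * D.weight c z =
      dressedMatrix D.pole D.index χ y' z i c := fun z hz => h.mul_weight_eq hD hχ hy' hz
  have hyy' : ∀ n ∈ D.index, y' n = y n := fun n =>
    (h.solvesGram hD hχ hM).eq_of_mem hD (fun j hj => (hχ j hj).1) hy
  have hdressed : dressedMatrix D.pole D.index χ y' z = dressedMatrix D.pole D.index χ y z :=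
    congrArg (1 - ·) (Finset.sum_congr rfl fun n hn => by rw [hyy' n hn])
  ext i c
  exact (eq_div_iff (D.weight_ne_zero hz c)).2 (hdressed ▸ hM z hz i c)

theorem differentiableAt_dressed (χ y : Matrix (Fin N) (Fin 2) ℂ) (hz : z ∉ D.poles)
    (i c : Fin 2) : DifferentiableAt ℂ (fun z => dressed D χ y z i c) z :=
  (differentiableAt_dressedMatrix χ y (fun _ hn => D.ne_conj_pole hz hn) i c).fun_div
    (D.differentiableAt_weight hz c) (D.weight_ne_zero hz c)

theorem isBigO_dressed (D : SolitonData N) (χ y : Matrix (Fin N) (Fin 2) ℂ) (i c : Fin 2) :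
    (fun z => dressed D χ y z i c - (1 : Matrix (Fin 2) (Fin 2) ℂ) i c)
      =O[Bornology.cobounded ℂ] fun z => z⁻¹ := by
  simp only [dressed, Matrix.of_apply, div_eq_mul_inv]
  exact isBigO_mul_sub (isBigO_dressedMatrix _ _ _ _ _ _) (isBigO_inv_s11_sub_one _ _)

theorem dressed_hasResidueRelation (hD : IsDiscreteSpectrum D.pole) (hχ : Represents α D x t χ)
    (hy : SolvesGram D.pole D.index χ y) (hj : j ∈ D.index) :
    HasResidueRelation (dressed D χ y) (D.pole j) (D.residueMatrix α x t j) := by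
  rw [D.residueMatrix_eq_single]
  have hrel := (hχ j hj).2
  have hχc := hχ.apply_ne_zero hD hj
  have hcol := D.mem_column hj
  have hcol' := D.notMem_column_rev j
  generalize D.singularColumn j = c at *
  have hd := s11Deriv_ne_zero hD (D.column c) j
  have hw : D.weight c.rev (D.pole j) ≠ 0 := s11_pole_ne_zero hD hcol'
  refine hasResidueRelation_single fun i =>
    ⟨_, (tendsto_dressedMatrix χ y hD.im_pos j i c.rev).div (tendsto_s11_pole hD.im_pos _ j) hw, ?_⟩
  have hker : dressedMatrix D.pole D.index χ y (D.pole j) i c * χ j c +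
      dressedMatrix D.pole D.index χ y (D.pole j) i c.rev * χ j c.rev = 0 := by
    rw [← sum_eq_add_rev fun b => dressedMatrix D.pole D.index χ y (D.pole j) i b * χ j b]
    exact congrFun (dressedMatrix_mulVec_eq_zero_iff.2 (hy j hj)) i
  have hres : dressedMatrix D.pole D.index χ y (D.pole j) i c / s11Deriv D.pole (D.column c) j =
      dressedMatrix D.pole D.index χ y (D.pole j) i c.rev / D.weight c.rev (D.pole j) *
        D.entry α x t j := by
    field_simp
    refine mul_right_cancel₀ hχc ?_
    linear_combination D.weight c.rev (D.pole j) * hker -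
      dressedMatrix D.pole D.index χ y (D.pole j) i c.rev * hrel
  exact hres ▸ ((tendsto_dressedMatrix χ y hD.im_pos j i c).div
    (tendsto_s11_div_sub hD.im_pos hcol) hd).congr fun z =>
      (div_div_eq_mul_div _ _ _).trans (by rw [mul_comm, mul_div_assoc]; rfl)

theorem dressed_hasResidueRelation_conj (hD : IsDiscreteSpectrum D.pole)
    (hχ : Represents α D x t χ) (hj : j ∈ D.index) :
    HasResidueRelation (dressed D χ y) (conj (D.pole j)) (D.residueMatrixConj α x t j) := by
  rw [D.residueMatrixConj_eq_single]
  have hrel := congrArg conj (hχ j hj).2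
  simp only [map_mul, map_neg] at hrel
  have hcol := D.mem_column hj
  have hcol' := D.notMem_column_rev j
  generalize D.singularColumn j = b at *
  obtain ⟨c, rfl⟩ := Fin.rev_surjective b
  rw [Fin.rev_rev] at *
  have hd : (conj (s11Deriv D.pole (D.column c.rev) j))⁻¹ ≠ 0 :=
    inv_ne_zero ((map_ne_zero _).2 (s11Deriv_ne_zero hD (D.column c.rev) j))
  have hw : (conj (D.weight c (D.pole j)))⁻¹ ≠ 0 :=
    inv_ne_zero ((map_ne_zero _).2 (s11_pole_ne_zero hD hcol'))
  have hpole := tendsto_sub_mul_dressedMatrix hD.injective χ y hj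
  refine hasResidueRelation_single fun i => ⟨_, tendsto_div_of_tendsto_sub_mul (hpole i c.rev)
    (tendsto_sub_mul_s11_conj hD hcol) hd, ?_⟩
  have hres : -(y j i * conj (χ j c)) / (conj (D.weight c (D.pole j)))⁻¹ =
      -(y j i * conj (χ j c.rev)) / (conj (s11Deriv D.pole (D.column c.rev) j))⁻¹ *
        -conj (D.entry α x t j) := by
    rw [div_inv_eq_mul, div_inv_eq_mul]
    linear_combination (-y j i) * hrel
  exact hres ▸ ((hpole i c).div (tendsto_s11_conj hD hcol') hw).congr fun z => mul_div_assoc _ _ _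

theorem dressed_solvesWeakRHP (hD : IsDiscreteSpectrum D.pole) (hχ : Represents α D x t χ)
    (hy : SolvesGram D.pole D.index χ y) : SolvesWeakRHP α D x t (dressed D χ y) where
  analytic i c _ hz := (differentiableAt_dressed χ y hz i c).differentiableWithinAt
  limit i c := tendsto_of_isBigO_inv (isBigO_dressed D χ y i c)
  residue _ hj := dressed_hasResidueRelation hD hχ hy hj
  residue_conj _ hj := dressed_hasResidueRelation_conj hD hχ hj

theorem dressed_solvesRHP (hD : IsDiscreteSpectrum D.pole) (hχ : Represents α D x t χ)
    (hy : SolvesGram D.pole D.index χ y) : SolvesRHP α D x t (dressed D χ y) where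
  analytic := (dressed_solvesWeakRHP hD hχ hy).analytic
  symmetry _ hz := ((dressed_solvesWeakRHP hD hχ hy).reflect.eq_dressed hD hχ hy hz).symm
  asymptotics := isBigO_dressed D χ y
  residue := (dressed_solvesWeakRHP hD hχ hy).residue
  residue_conj := (dressed_solvesWeakRHP hD hχ hy).residue_conj

theorem exists_solvesRHP (hD : IsDiscreteSpectrum D.pole) (α x t : ℝ) :
    ∃ M, SolvesRHP α D x t M := by
  obtain ⟨χ, hχ⟩ := exists_represents hD α x t
  obtain ⟨y, hy⟩ := exists_solvesGram hD fun j hj => (hχ j hj).1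
  exact ⟨_, dressed_solvesRHP hD hχ hy⟩

theorem SolvesRHP.eq {M' : ℂ → Matrix (Fin 2) (Fin 2) ℂ} (hD : IsDiscreteSpectrum D.pole)
    (h : SolvesRHP α D x t M) (h' : SolvesRHP α D x t M') (hz : z ∉ D.poles) : M z = M' z := by
  obtain ⟨χ, hχ⟩ := exists_represents hD α x t
  obtain ⟨y, hy⟩ := exists_solvesGram hD fun j hj => (hχ j hj).1
  rw [h.weak.eq_dressed hD hχ hy hz, h'.weak.eq_dressed hD hχ hy hz]

/-! The value of the soliton solution -/

section Pairing

open Matrix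

open scoped Matrix.Norms.Operator in
theorem hasDerivAt_matrix_inv {ι : Type*} [Fintype ι] [DecidableEq ι] {F : ℝ → Matrix ι ι ℂ}
    {F' : Matrix ι ι ℂ} {t : ℝ} (hF : HasDerivAt F F' t) (hdet : (F t).det ≠ 0) :
    HasDerivAt (fun τ => (F τ)⁻¹) (-((F t)⁻¹ * F' * (F t)⁻¹)) t := by
  obtain ⟨u, hu⟩ := (Matrix.isUnit_iff_isUnit_det (F t)).2 (isUnit_iff_ne_zero.2 hdet)
  have hinv : HasFDerivAt Ring.inverse (-ContinuousLinearMap.mulLeftRight ℝ _ ↑u⁻¹ ↑u⁻¹) (F t) :=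
    hu ▸ hasFDerivAt_ringInverse u
  refine ((hinv.comp_hasDerivAt t hF).congr_of_eventuallyEq
    (Eventually.of_forall fun τ => nonsing_inv_eq_ringInverse (F τ))).congr_deriv ?_
  simp [← hu]

variable {ι m : Type*} [Fintype ι] [DecidableEq ι] [Fintype m]

/-- The form `g^† G⁻¹ f`, where `G` is the matrix of the linear system with the kernel vectors
`χ`. The soliton solution is expressed by its values. -/
def gramPairing (k : ι → ℂ) (χ : Matrix ι m ℂ) (f g : ι → ℂ) : ℂ :=
  star g ⬝ᵥ (gram k χ)⁻¹ *ᵥ f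

theorem hasDerivAt_gramPairing {k : ι → ℂ} {F : ℝ → Matrix ι m ℂ} {G' : Matrix ι ι ℂ} {t : ℝ}
    (hG : ∀ i j, HasDerivAt (fun τ => gram k (F τ) i j) (G' i j) t)
    (hdet : (gram k (F t)).det ≠ 0) (f g : ι → ℂ) :
    HasDerivAt (fun τ => gramPairing k (F τ) f g)
      (-(star g ⬝ᵥ ((gram k (F t))⁻¹ * G' * (gram k (F t))⁻¹) *ᵥ f)) t := by
  have hinv := hasDerivAt_matrix_inv (hasDerivAt_pi.2 fun i => hasDerivAt_pi.2 (hG i)) hdet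
  have h : HasDerivAt (fun τ => gramPairing k (F τ) f g)
      (star g ⬝ᵥ (-((gram k (F t))⁻¹ * G' * (gram k (F t))⁻¹)) *ᵥ f) t :=
    HasDerivAt.fun_sum fun i _ => (HasDerivAt.fun_sum fun j _ =>
      (hasDerivAt_pi.1 (hasDerivAt_pi.1 hinv i) j).mul_const (f j)).const_mul (star g i)
  rwa [neg_mulVec, dotProduct_neg] at h

theorem hasDerivAt_gramPairing_of_rankOne {k : ι → ℂ} {F : ℝ → Matrix ι m ℂ} {w : ℂ} {a : ι → ℂ}
    {t : ℝ} (hG : ∀ i j, HasDerivAt (fun τ => gram k (F τ) i j) (-(w * (a i * conj (a j)))) t)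
    (hdet : (gram k (F t)).det ≠ 0) (f g : ι → ℂ) :
    HasDerivAt (fun τ => gramPairing k (F τ) f g)
      (w * (gramPairing k (F t) f a * gramPairing k (F t) a g)) t := by
  refine (hasDerivAt_gramPairing (G' := -(w • vecMulVec a (star a))) hG hdet f g).congr_deriv ?_
  simp [gramPairing, neg_mulVec, smul_mulVec, ← mulVec_mulVec, vecMulVec_mulVec, mulVec_smul]

theorem tendsto_mul_div_sub_cobounded (a p : ℂ) :
    Tendsto (fun z => z * (a / (z - p))) (Bornology.cobounded ℂ) (𝓝 a) := by
  have h := ((isBigO_div_sub (p * a) p).trans_tendsto tendsto_inv₀_cobounded).const_add a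
  rw [add_zero] at h
  refine h.congr' ?_
  filter_upwards [Bornology.eventually_ne_cobounded p] with z hz
  have := sub_ne_zero.2 hz
  field_simp
  ring

theorem tendsto_mul_gramPairing (k : ι → ℂ) (χ : Matrix ι m ℂ) (f g : ι → ℂ) :
    Tendsto (fun z => z * gramPairing k χ f fun n => g n / (conj z - k n))
      (Bornology.cobounded ℂ) (𝓝 (gramPairing k χ f g)) := by
  have h := tendsto_finsetSum Finset.univ fun n _ =>
    tendsto_mul_div_sub_cobounded (conj (g n) * ((gram k χ)⁻¹ *ᵥ f) n) (conj (k n))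
  refine h.congr fun z => ?_
  simp only [gramPairing, dotProduct, Pi.star_apply, RCLike.star_def, map_div₀, map_sub,
    Complex.conj_conj, div_mul_eq_mul_div, Finset.mul_sum]


theorem dressedMatrix_univ_apply [DecidableEq m] (k : ι → ℂ) (χ : Matrix ι m ℂ) (z : ℂ) (i c : m) :
    dressedMatrix k Finset.univ χ (Complex.I • ((gram k χ)⁻¹ * χ)) z i c =
      (1 : Matrix m m ℂ) i c -
        Complex.I * gramPairing k χ (χ.col i) fun n => χ n c / (conj z - k n) := by
  rw [dressedMatrix_apply, gramPairing, dotProduct, Finset.mul_sum]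
  congr 1
  refine Finset.sum_congr rfl fun n _ => ?_
  simp only [Pi.star_apply, RCLike.star_def, map_div₀, map_sub, Complex.conj_conj,
    Matrix.smul_apply, smul_eq_mul, mul_apply, mulVec, dotProduct, col_apply]
  ring


end Pairing

/-- The value of `A` in terms of the kernel vectors. -/
def valueA (k : Fin N → ℂ) (χ : Matrix (Fin N) (Fin 2) ℂ) : ℂ :=
  4 * gramPairing k χ (χ.col 0) (χ.col 1)

/-- The value of `B` in terms of the kernel vectors. -/
def valueB (α β : ℝ) (k : Fin N → ℂ) (χ : Matrix (Fin N) (Fin 2) ℂ) : ℂ :=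
  -(2 * α / β) *
    (gramPairing k χ (χ.col 0) (χ.col 1 / k) * gramPairing k χ (χ.col 1 / k) (χ.col 0))

/-- The factor `exp (-i α (τ - t) / (2 z))` by which `exp (2 i t θ(z))` changes from time `t` to
time `τ`. -/
def timeFactor (α t τ : ℝ) (z : ℂ) : ℂ := Complex.exp (-(Complex.I * α / (2 * z)) * (τ - t))

theorem timeFactor_self (α t : ℝ) (z : ℂ) : timeFactor α t t z = 1 := by simp [timeFactor]

theorem timeFactor_ne_zero (α t τ : ℝ) (z : ℂ) : timeFactor α t τ z ≠ 0 := Complex.exp_ne_zero _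

theorem exp_tTheta (hz : z ≠ 0) (α x t τ : ℝ) :
    Complex.exp (2 * Complex.I * tTheta α x τ z) =
      Complex.exp (2 * Complex.I * tTheta α x t z) * timeFactor α t τ z := by
  rw [timeFactor, ← Complex.exp_add]
  congr 1
  simp only [tTheta]
  field_simp
  ring

theorem hasDerivAt_timeFactor (α t : ℝ) (z : ℂ) :
    HasDerivAt (fun τ => timeFactor α t τ z) (-(Complex.I * α / (2 * z))) t := by
  have hexponent : HasDerivAt (fun τ : ℝ => -(Complex.I * α / (2 * z)) * ((τ : ℂ) - t))
      (-(Complex.I * α / (2 * z)) * 1) t :=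
    ((Complex.ofRealCLM.hasDerivAt (x := t)).sub_const (t : ℂ)).const_mul _
  exact hexponent.cexp.congr_deriv (by simp)

/-- The evolution in time of the kernel vectors `χ`, starting at time `t`. -/
def evolve (α : ℝ) (k : Fin N → ℂ) (χ : Matrix (Fin N) (Fin 2) ℂ) (t τ : ℝ) :
    Matrix (Fin N) (Fin 2) ℂ :=
  Matrix.of fun j => ![χ j 0, χ j 1 * timeFactor α t τ (k j)]

theorem evolve_apply_zero (α : ℝ) (k : Fin N → ℂ) (χ : Matrix (Fin N) (Fin 2) ℂ) (t τ : ℝ)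
    (j : Fin N) : evolve α k χ t τ j 0 = χ j 0 := rfl

theorem evolve_apply_one (α : ℝ) (k : Fin N → ℂ) (χ : Matrix (Fin N) (Fin 2) ℂ) (t τ : ℝ)
    (j : Fin N) : evolve α k χ t τ j 1 = χ j 1 * timeFactor α t τ (k j) := rfl

theorem evolve_self (α : ℝ) (k : Fin N → ℂ) (χ : Matrix (Fin N) (Fin 2) ℂ) (t : ℝ) :
    evolve α k χ t t = χ := by
  ext j c
  fin_cases c
  exacts [rfl, by simp [evolve, timeFactor_self]]

theorem evolve_ne_zero (h : χ j ≠ 0) (α t τ : ℝ) : evolve α k χ t τ j ≠ 0 := by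
  intro h0
  have hentry (c) : evolve α k χ t τ j c = 0 := congrFun h0 c
  refine h (funext fun c => ?_)
  fin_cases c
  exacts [hentry 0, (mul_eq_zero.1 (hentry 1)).resolve_right (timeFactor_ne_zero _ _ _ _)]

theorem IsDiscreteSpectrum.ne_zero (hk : IsDiscreteSpectrum k) (j : Fin N) : k j ≠ 0 := fun h =>
  (hk.im_pos j).ne' (by rw [h, Complex.zero_im])

theorem exp_neg_tTheta (α x t : ℝ) (z : ℂ) :
    Complex.exp (-2 * Complex.I * tTheta α x t z) =
      (Complex.exp (2 * Complex.I * tTheta α x t z))⁻¹ := by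
  rw [← Complex.exp_neg, neg_mul, neg_mul]

theorem Represents.evolve (hD : IsDiscreteSpectrum D.pole) (hχ : Represents α D x t χ) (τ : ℝ) :
    Represents α D x τ (evolve α D.pole χ t τ) := by
  intro j hj
  obtain ⟨hne, hrel⟩ := hχ j hj
  refine ⟨evolve_ne_zero hne _ _ _, ?_⟩
  have hphase := exp_tTheta (hD.ne_zero j) α x t τ
  have hfactor := timeFactor_ne_zero α t τ (D.pole j)
  have hrev_zero : (0 : Fin 2).rev = 1 := rfl
  have hrev_one : (1 : Fin 2).rev = 0 := rfl
  by_cases hn : j ∈ D.nabla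
  · simp only [SolitonData.singularColumn, SolitonData.entry, hn, if_true, hrev_one,
      evolve_apply_zero, evolve_apply_one, exp_neg_tTheta] at hrel ⊢
    rw [hphase, hrel]
    field_simp
  · simp only [SolitonData.singularColumn, SolitonData.entry, hn, if_false, hrev_zero,
      evolve_apply_zero, evolve_apply_one] at hrel ⊢
    rw [hphase]
    linear_combination timeFactor α t τ (D.pole j) * hrel

theorem hasDerivAt_gram_evolve (hk : IsDiscreteSpectrum k) (α : ℝ)
    (χ : Matrix (Fin N) (Fin 2) ℂ) (t : ℝ) (j n : Fin N) :
    HasDerivAt (fun τ => gram k (evolve α k χ t τ) j n)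
      (-(α / 2 * ((χ.col 1 / k) j * conj ((χ.col 1 / k) n)))) t := by
  have hone (l) : HasDerivAt (fun τ => evolve α k χ t τ l 1)
      (χ l 1 * -(Complex.I * α / (2 * k l))) t :=
    (hasDerivAt_timeFactor α t (k l)).const_mul _
  have hgram : HasDerivAt (fun τ => gram k (evolve α k χ t τ) j n) _ t :=
    (((hone j).fun_mul (hone n).star).const_add (χ j 0 * conj (χ n 0))).const_mul
      (cauchyGram k j n) |>.congr_of_eventuallyEq (Eventually.of_forall fun τ => by
        simp [gram, Matrix.mul_apply, evolve_apply_zero])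
  refine hgram.congr_deriv ?_
  have hj := hk.ne_zero j
  have hn : conj (k n) ≠ 0 := (map_ne_zero _).2 (hk.ne_zero n)
  have hjn := sub_conj_ne_zero (hk.im_pos j) (hk.im_pos n)
  simp only [evolve_self, cauchyGram, Matrix.of_apply, RCLike.star_def, map_mul, map_neg, map_div₀,
    Complex.conj_I, Complex.conj_ofReal, map_ofNat, Pi.div_apply, Matrix.col_apply]
  field_simp
  linear_combination (α * χ j 1 * conj (χ n 1) * (k j - conj (k n))) * Complex.I_sq

theorem SolitonData.compl_poles_mem_cobounded (D : SolitonData N) :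
    D.polesᶜ ∈ Bornology.cobounded ℂ :=
  Bornology.isBounded_def.1 D.finite_poles.isBounded

theorem SolvesWeakRHP.apply_eq (hD : IsDiscreteSpectrum D.pole) (hindex : D.index = Finset.univ)
    (h : SolvesWeakRHP α D x t M) (hχ : Represents α D x t χ) (hz : z ∉ D.poles) (i c : Fin 2) :
    M z i c = ((1 : Matrix (Fin 2) (Fin 2) ℂ) i c - Complex.I *
      gramPairing D.pole χ (χ.col i) fun n => χ n c / (conj z - D.pole n)) / D.weight c z := by
  have hχ0 (j) : χ j ≠ 0 := (hχ j (hindex ▸ Finset.mem_univ j)).1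
  rw [h.eq_dressed hD hχ (hindex ▸ solvesGram_univ hD hχ0) hz, dressed, Matrix.of_apply, hindex,
    dressedMatrix_univ_apply]

theorem tendsto_mul_gramPairing_div_weight (D : SolitonData N) (χ : Matrix (Fin N) (Fin 2) ℂ)
    (f g : Fin N → ℂ) (c : Fin 2) :
    Tendsto (fun z => z * (gramPairing D.pole χ f (fun n => g n / (conj z - D.pole n)) /
      D.weight c z)) (Bornology.cobounded ℂ) (𝓝 (gramPairing D.pole χ f g)) := by
  have h := (tendsto_mul_gramPairing D.pole χ f g).div (tendsto_s11_cobounded D.pole (D.column c))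
    one_ne_zero
  rw [div_one] at h
  exact h.congr fun z => mul_div_assoc _ _ _

theorem recoversA_valueA (hD : IsDiscreteSpectrum D.pole) (hindex : D.index = Finset.univ)
    {M : ℝ → ℝ → ℂ → Matrix (Fin 2) (Fin 2) ℂ} (hM : SolvesWeakRHP α D x t (M x t))
    (hχ : Represents α D x t χ) : RecoversA M x t (valueA D.pole χ) := by
  refine ((tendsto_mul_gramPairing_div_weight D χ (χ.col 0) (χ.col 1) 1).const_mul 4).congr' ?_
  filter_upwards [D.compl_poles_mem_cobounded] with z hz
  rw [hM.apply_eq hD hindex hχ hz]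
  simp only [Matrix.one_apply_ne zero_ne_one, Matrix.col_apply]
  linear_combination (4 * z * gramPairing D.pole χ (χ.col 0)
    (fun n => χ n 1 / (conj z - D.pole n)) / D.weight 1 z) * Complex.I_mul_I

theorem hasDerivAt_mul_apply (hD : IsDiscreteSpectrum D.pole) (hindex : D.index = Finset.univ)
    {M : ℝ → ℝ → ℂ → Matrix (Fin 2) (Fin 2) ℂ} (hM : ∀ y τ, SolvesWeakRHP α D y τ (M y τ))
    (hχ : Represents α D x t χ) (hz : z ∉ D.poles) :
    HasDerivAt (fun τ => z * M x τ z 0 0)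
      (-(Complex.I * (α / 2) * gramPairing D.pole χ (χ.col 0) (χ.col 1 / D.pole)) *
        (z * (gramPairing D.pole χ (χ.col 1 / D.pole) (fun n => χ n 0 / (conj z - D.pole n)) /
          D.weight 0 z))) t := by
  have hχ0 (j) : χ j ≠ 0 := (hχ j (hindex ▸ Finset.mem_univ j)).1
  have hdet := gram_det_ne_zero hD fun j => evolve_ne_zero (k := D.pole) (hχ0 j) α t t
  have hpairing := hasDerivAt_gramPairing_of_rankOne (hasDerivAt_gram_evolve hD α χ t) hdet
    (χ.col 0) fun n => χ n 0 / (conj z - D.pole n)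
  have hformula (τ) : z * M x τ z 0 0 = z * ((1 - Complex.I *
      gramPairing D.pole (ABSystem.evolve α D.pole χ t τ) (χ.col 0)
        fun n => χ n 0 / (conj z - D.pole n)) / D.weight 0 z) := by
    rw [(hM x τ).apply_eq hD hindex (hχ.evolve hD τ) hz]
    rfl
  simp only [hformula]
  refine ((((hpairing.const_mul Complex.I).const_sub 1).div_const _).const_mul z).congr_deriv ?_
  rw [evolve_self]
  ring

theorem recoversB_valueB (hD : IsDiscreteSpectrum D.pole) (hindex : D.index = Finset.univ)
    {M : ℝ → ℝ → ℂ → Matrix (Fin 2) (Fin 2) ℂ} (hM : ∀ y τ, SolvesWeakRHP α D y τ (M y τ))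
    (hχ : Represents α D x t χ) (β : ℝ) : RecoversB β M x t (valueB α β D.pole χ) := by
  have hpoles := D.compl_poles_mem_cobounded
  have hderiv (z) (hz : z ∈ D.polesᶜ) := hasDerivAt_mul_apply hD hindex hM hχ hz
  refine ⟨mem_of_superset hpoles fun z hz => (hderiv z hz).differentiableAt, ?_⟩
  have hlim := ((tendsto_mul_gramPairing_div_weight D χ (χ.col 1 / D.pole) (χ.col 0) 0).const_mul
    (-(Complex.I * (α / 2) * gramPairing D.pole χ (χ.col 0) (χ.col 1 / D.pole)))).const_mul
    (-(4 * Complex.I / β))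
  have hvalue : -(4 * Complex.I / β) *
      (-(Complex.I * (α / 2) * gramPairing D.pole χ (χ.col 0) (χ.col 1 / D.pole)) *
        gramPairing D.pole χ (χ.col 1 / D.pole) (χ.col 0)) = valueB α β D.pole χ := by
    rw [valueB]
    linear_combination (2 * α / β * (gramPairing D.pole χ (χ.col 0) (χ.col 1 / D.pole) *
      gramPairing D.pole χ (χ.col 1 / D.pole) (χ.col 0))) * Complex.I_mul_I
  rw [← hvalue]
  refine hlim.congr' ?_
  filter_upwards [hpoles] with z hz
  rw [(hderiv z hz).deriv]
  rfl

theorem isSolitonValue (hD : IsDiscreteSpectrum D.pole) {a b : ℂ} {β : ℝ}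
    (h : ∀ M : ℝ → ℝ → ℂ → Matrix (Fin 2) (Fin 2) ℂ, (∀ y τ, SolvesRHP α D y τ (M y τ)) →
      RecoversA M x t a ∧ RecoversB β M x t b) : IsSolitonValue α β D x t a b where
  exists_solution := by
    choose M hM using exists_solvesRHP hD α
    exact ⟨M, hM⟩
  unique_solution _ _ _ _ h h' _ hz := h.eq hD h' hz
  recovers := h

/-! The kernel vectors of modulated data -/

/-- The constant in the residue condition at `k_j` that is obtained from the norming constant `a`
by moving the poles in `nabla` to the second column. -/
def modulatedCoeff (k : Fin N → ℂ) (a : ℂ) (nabla : Finset (Fin N)) (j : Fin N) : ℂ :=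
  if j ∈ nabla then a⁻¹ * (s11Deriv k nabla j ^ 2)⁻¹ else a * s11 k nabla (k j) ^ 2

theorem modulatedData_coeff (hk : IsDiscreteSpectrum k) (c d : Fin N → ℂ)
    (S nabla : Finset (Fin N)) (j : Fin N) :
    (modulatedData k c d S nabla).coeff j = modulatedCoeff k (c j * (d j ^ 2)⁻¹) nabla j := by
  simp only [modulatedData, modulatedCoeff]
  split_ifs with h
  · rw [(hasDerivAt_s11 hk.im_pos h).deriv, mul_inv, inv_inv]
    ring
  · ring

theorem modulatedCoeff_union (h : Disjoint A B) (hj : j ∉ B) (a : ℂ) :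
    modulatedCoeff k a (A ∪ B) j = modulatedCoeff k (a * s11 k B (k j) ^ 2) A j := by
  by_cases hA : j ∈ A
  · simp only [modulatedCoeff, Finset.mem_union_left B hA, hA, if_true, s11Deriv_union h hA]
    simp only [mul_pow, mul_inv]
    ring
  · simp only [modulatedCoeff, Finset.mem_union, hA, hj, or_self, if_false, s11_union h]
    ring

/-- The quotient `χ_j 1 / χ_j 0` of the entries of the kernel vector at `k_j` for the norming
constant `a`, when all eigenvalues are present. -/
def kernelRatio (α x t : ℝ) (k : Fin N → ℂ) (a : ℂ) (j : Fin N) : ℂ :=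
  -(a * Complex.exp (2 * Complex.I * tTheta α x t (k j)) * s11Deriv k Finset.univ j)

theorem SolitonData.column_zero (D : SolitonData N) : D.column 0 = D.index \ D.nabla := by
  ext j
  by_cases h : j ∈ D.nabla <;> simp [column, singularColumn, h]

theorem SolitonData.column_one (D : SolitonData N) : D.column 1 = D.index ∩ D.nabla := by
  ext j
  by_cases h : j ∈ D.nabla <;> simp [column, singularColumn, h]

/- The set `∇` drops out of the kernel vector: moving poles to the other column multiplies the
residue constant and the Blaschke weights by the same factors. -/
theorem kernelRatio_relation (hD : IsDiscreteSpectrum D.pole) (hindex : D.index = Finset.univ)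
    {a : ℂ} (ha : a ≠ 0) (hcoeff : D.coeff j = modulatedCoeff D.pole a D.nabla j)
    (hχ : χ j 1 = kernelRatio α x t D.pole a j * χ j 0) :
    χ j (D.singularColumn j).rev * D.weight (D.singularColumn j).rev (D.pole j) =
      -(D.entry α x t j * s11Deriv D.pole (D.column (D.singularColumn j)) j *
        χ j (D.singularColumn j)) := by
  have hdisj : Disjoint D.nabla D.nablaᶜ := disjoint_compl_right
  have hrev_zero : (0 : Fin 2).rev = 1 := rfl
  have hrev_one : (1 : Fin 2).rev = 0 := rfl
  have hcolumn_zero : D.column 0 = D.nablaᶜ := by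
    rw [D.column_zero, hindex, Finset.compl_eq_univ_sdiff]
  have hcolumn_one : D.column 1 = D.nabla := by rw [D.column_one, hindex, Finset.univ_inter]
  have hunion : Finset.univ = D.nabla ∪ D.nablaᶜ := (Finset.union_compl _).symm
  by_cases hj : j ∈ D.nabla
  · have hderiv := s11Deriv_ne_zero hD D.nabla j
    have hexp := Complex.exp_ne_zero (2 * Complex.I * tTheta α x t (D.pole j))
    simp only [SolitonData.singularColumn, SolitonData.entry, SolitonData.weight, hcoeff,
      modulatedCoeff, hj, if_true, hrev_one, exp_neg_tTheta, hχ, kernelRatio, hcolumn_zero,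
      hcolumn_one]
    rw [hunion, s11Deriv_union hdisj hj]
    field_simp
  · simp only [SolitonData.singularColumn, SolitonData.entry, SolitonData.weight, hcoeff,
      modulatedCoeff, hj, if_false, hrev_zero, hχ, kernelRatio, hcolumn_zero, hcolumn_one]
    rw [hunion, Finset.union_comm, s11Deriv_union hdisj.symm (Finset.mem_compl.2 hj)]
    ring

theorem isSolitonValue_of_represents {D' : SolitonData N} (hD : IsDiscreteSpectrum D.pole)
    (hD' : IsDiscreteSpectrum D'.pole) (hindex : D'.index = Finset.univ)
    (h : ∀ {y τ M}, SolvesRHP α D y τ M → SolvesWeakRHP α D' y τ M)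
    (hχ : Represents α D' x t χ) (β : ℝ) :
    IsSolitonValue α β D x t (valueA D'.pole χ) (valueB α β D'.pole χ) :=
  isSolitonValue hD fun _ hM => ⟨recoversA_valueA hD' hindex (h (hM x t)) hχ,
    recoversB_valueB hD' hindex (fun y τ => h (hM y τ)) hχ β⟩

theorem delta_ne_zero (α : ℝ) (r : ℝ → ℂ) (κ : ℝ) (z : ℂ) : delta α r κ z ≠ 0 :=
  Complex.exp_ne_zero _

/-- The norming constants of the modulated data before the poles in `∇` are moved. -/
def modulatedConst (α : ℝ) (r : ℝ → ℂ) (k c : Fin N → ℂ) (κ : ℝ) (j : Fin N) : ℂ :=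
  c j * (delta α r κ (k j) ^ 2)⁻¹

theorem modulatedConst_ne_zero {c : Fin N → ℂ} (hc : c j ≠ 0) (α : ℝ) (r : ℝ → ℂ)
    (k : Fin N → ℂ) (κ : ℝ) : modulatedConst α r k c κ j ≠ 0 :=
  mul_ne_zero hc (inv_ne_zero (pow_ne_zero 2 (delta_ne_zero _ _ _ _)))

theorem fullData_isSolitonValue (hk : IsDiscreteSpectrum k) {r : ℝ → ℂ} {c : Fin N → ℂ}
    (hc : ∀ j, c j ≠ 0) {κ : ℝ} (nabla : Finset (Fin N)) (hχ0 : ∀ j, χ j ≠ 0)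
    (hχ : ∀ j, χ j 1 = kernelRatio α x t k (modulatedConst α r k c κ j) j * χ j 0) (β : ℝ) :
    IsSolitonValue α β (fullData α r k c κ nabla) x t (valueA k χ) (valueB α β k χ) := by
  refine isSolitonValue_of_represents (D := fullData α r k c κ nabla)
    (D' := fullData α r k c κ nabla) hk hk rfl (fun h => h.weak) (fun j _ => ⟨hχ0 j, ?_⟩) β
  exact kernelRatio_relation hk rfl (modulatedConst_ne_zero (hc j) α r k κ)
    (modulatedData_coeff hk _ _ _ _ j) (hχ j)

/-- The data on all eigenvalues that agree with `D` on `D.index`, and are trivial elsewhere, with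
the eigenvalues in `F` assigned to the second column. -/
def SolitonData.extend (D : SolitonData N) (F : Finset (Fin N)) : SolitonData N where
  index := Finset.univ
  pole := D.pole
  coeff j := if j ∈ D.index then D.coeff j else 0
  nabla := D.nabla ∪ F

theorem SolitonData.entry_eq_zero (h : D.coeff j = 0) : D.entry α x t j = 0 := by
  rw [entry, h, zero_mul]

theorem hasResidueRelation_zero (h : ∀ i c, ContinuousAt (fun z => M z i c) p) :
    HasResidueRelation M p 0 := by
  refine ⟨0, tendsto_pi_nhds.2 fun i => tendsto_pi_nhds.2 fun c => ?_, by
    simp only [mul_zero, tendsto_const_nhds]⟩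
  have hlim := (tendsto_sub_nhdsNE p).mul ((h i c).tendsto.mono_left nhdsWithin_le_nhds)
  rwa [zero_mul] at hlim

theorem SolitonData.pole_notMem_poles (hD : IsDiscreteSpectrum D.pole) (hj : j ∉ D.index) :
    D.pole j ∉ D.poles := by
  rintro ⟨n, hn, hjn | hjn⟩
  · exact hj (hD.injective hjn ▸ hn)
  · exact ne_conj_of_im_pos (hD.im_pos j) (hD.im_pos n) hjn

theorem SolvesWeakRHP.extend (hD : IsDiscreteSpectrum D.pole) (h : SolvesWeakRHP α D x t M)
    {F : Finset (Fin N)} (hF : Disjoint D.index F) : SolvesWeakRHP α (D.extend F) x t M := by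
  have hcont {p} (hp : p ∉ D.poles) (i c) : ContinuousAt (fun z => M z i c) p :=
    ((h.analytic i c).differentiableAt (D.isOpen_compl_poles.mem_nhds hp)).continuousAt
  have hmem {j} (hj : j ∈ D.index) : j ∈ D.nabla ∪ F ↔ j ∈ D.nabla := by
    simp [Finset.disjoint_left.1 hF hj]
  have hentry {j} (hj : j ∉ D.index) : (D.extend F).entry α x t j = 0 :=
    SolitonData.entry_eq_zero (if_neg hj)
  refine ⟨fun i c => (h.analytic i c).mono (Set.compl_subset_compl.2 ?_), h.limit,
    fun j _ => ?_, fun j _ => ?_⟩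
  · rintro z ⟨j, -, hz⟩
    exact ⟨j, Finset.mem_univ _, hz⟩
  all_goals by_cases hj : j ∈ D.index
  · simpa only [SolitonData.residueMatrix, SolitonData.extend, hj, if_true, hmem hj]
      using h.residue j hj
  · rw [SolitonData.residueMatrix_eq_single, hentry hj, Matrix.single_zero]
    exact hasResidueRelation_zero (hcont (D.pole_notMem_poles hD hj))
  · simpa only [SolitonData.residueMatrixConj, SolitonData.extend, hj, if_true, hmem hj]
      using h.residue_conj j hj
  · rw [SolitonData.residueMatrixConj_eq_single, hentry hj, map_zero, neg_zero, Matrix.single_zero]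
    exact hasResidueRelation_zero (hcont (D.conj_notMem_poles (D.pole_notMem_poles hD hj)))

theorem insideConst_eq (α v₁ v₂ : ℝ) (k c : Fin N → ℂ) (κ : ℝ) (j : Fin N) :
    insideConst α v₁ v₂ k c κ j =
      c j * s11 k (fastSet α k κ \ inside α v₁ v₂ k) (k j) ^ 2 := by
  rw [insideConst, s11, Finset.prod_pow]

theorem extend_insideData_coeff (hk : IsDiscreteSpectrum k) {v₁ v₂ : ℝ} (r : ℝ → ℂ)
    (c : Fin N → ℂ) (κ : ℝ) (nabla : Finset (Fin N)) (hj : j ∈ inside α v₁ v₂ k) :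
    ((insideData α v₁ v₂ r k c κ nabla).extend (fastSet α k κ \ inside α v₁ v₂ k)).coeff j =
      modulatedCoeff k (modulatedConst α r k c κ j)
        (nabla ∩ inside α v₁ v₂ k ∪ fastSet α k κ \ inside α v₁ v₂ k) j := by
  have hdisj : Disjoint (nabla ∩ inside α v₁ v₂ k) (fastSet α k κ \ inside α v₁ v₂ k) :=
    Finset.disjoint_sdiff.mono_left Finset.inter_subset_right
  rw [modulatedCoeff_union hdisj fun h => (Finset.mem_sdiff.1 h).2 hj]
  refine (if_pos hj).trans ((modulatedData_coeff hk _ _ _ _ j).trans ?_)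
  rw [insideConst_eq, modulatedConst, mul_right_comm]

/-- The rows `χ_j` are kernel vectors for the eigenvalues inside `𝓘`, and coordinate vectors, with
the trivial entry given by the velocity, for the eigenvalues outside `𝓘`. -/
structure IsInsideKernel (α v₁ v₂ : ℝ) (r : ℝ → ℂ) (k c : Fin N → ℂ) (κ x t : ℝ)
    (χ : Matrix (Fin N) (Fin 2) ℂ) : Prop where
  ne_zero : ∀ j, χ j ≠ 0
  ratio : ∀ j ∈ inside α v₁ v₂ k,
    χ j 1 = kernelRatio α x t k (modulatedConst α r k c κ j) j * χ j 0
  apply_zero : ∀ j ∉ inside α v₁ v₂ k, j ∈ fastSet α k κ → χ j 0 = 0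
  apply_one : ∀ j ∉ inside α v₁ v₂ k, j ∉ fastSet α k κ → χ j 1 = 0

theorem IsInsideKernel.represents (hk : IsDiscreteSpectrum k) {v₁ v₂ κ : ℝ} {r : ℝ → ℂ}
    {c : Fin N → ℂ} (hc : ∀ j, c j ≠ 0) (hχ : IsInsideKernel α v₁ v₂ r k c κ x t χ)
    (nabla : Finset (Fin N)) :
    Represents α ((insideData α v₁ v₂ r k c κ nabla).extend
      (fastSet α k κ \ inside α v₁ v₂ k)) x t χ := by
  set D := (insideData α v₁ v₂ r k c κ nabla).extend (fastSet α k κ \ inside α v₁ v₂ k)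
    with hD
  refine fun j _ => ⟨hχ.ne_zero j, ?_⟩
  by_cases hj : j ∈ inside α v₁ v₂ k
  · exact kernelRatio_relation (D := D) hk rfl (modulatedConst_ne_zero (hc j) α r k κ)
      (extend_insideData_coeff hk r c κ nabla hj) (hχ.ratio j hj)
  · have hentry : D.entry α x t j = 0 := SolitonData.entry_eq_zero (if_neg hj)
    have hnabla : j ∈ D.nabla ↔ j ∈ fastSet α k κ := by
      simp [hD, SolitonData.extend, insideData, modulatedData, hj]
    suffices h : χ j (D.singularColumn j).rev = 0 by rw [h, hentry]; ring
    by_cases hfast : j ∈ fastSet α k κ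
    · rw [SolitonData.singularColumn, if_pos (hnabla.2 hfast)]
      exact hχ.apply_zero j hj hfast
    · rw [SolitonData.singularColumn, if_neg (mt hnabla.1 hfast)]
      exact hχ.apply_one j hj hfast

theorem insideData_isSolitonValue (hk : IsDiscreteSpectrum k) {v₁ v₂ κ : ℝ} {r : ℝ → ℂ}
    {c : Fin N → ℂ} (hc : ∀ j, c j ≠ 0) (hχ : IsInsideKernel α v₁ v₂ r k c κ x t χ)
    (nabla : Finset (Fin N)) (β : ℝ) :
    IsSolitonValue α β (insideData α v₁ v₂ r k c κ nabla) x t (valueA k χ) (valueB α β k χ) :=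
  isSolitonValue_of_represents (D := insideData α v₁ v₂ r k c κ nabla)
    (D' := (insideData α v₁ v₂ r k c κ nabla).extend (fastSet α k κ \ inside α v₁ v₂ k)) hk hk rfl
    (fun h => h.weak.extend hk Finset.disjoint_sdiff) (hχ.represents hk hc nabla) β

/-! Stability of the value under perturbations of the kernel vectors -/

section Stability

open Matrix

variable {T : Type*} {l : Filter T} {ε : T → ℝ} {f f₀ g g₀ : T → ℂ}

/-- The functions `f` and `f₀` are bounded along `l`, and their difference is `O(ε)`. -/
structure BoundedClose (l : Filter T) (ε : T → ℝ) (f f₀ : T → ℂ) : Prop where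
  left : f =O[l] fun _ => (1 : ℝ)
  right : f₀ =O[l] fun _ => (1 : ℝ)
  sub : (fun p => f p - f₀ p) =O[l] ε

theorem boundedClose_const (l : Filter T) (ε : T → ℝ) (a : ℂ) :
    BoundedClose l ε (fun _ => a) fun _ => a where
  left := Asymptotics.isBigO_const_const a one_ne_zero l
  right := Asymptotics.isBigO_const_const a one_ne_zero l
  sub := by simpa only [sub_self] using Asymptotics.isBigO_zero ε l

theorem BoundedClose.mul (hf : BoundedClose l ε f f₀) (hg : BoundedClose l ε g g₀) :
    BoundedClose l ε (fun p => f p * g p) fun p => f₀ p * g₀ p where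
  left := by simpa only [mul_one] using hf.left.mul hg.left
  right := by simpa only [mul_one] using hf.right.mul hg.right
  sub := by
    have hleft := hf.sub.mul hg.left
    have hright := hf.right.mul hg.sub
    simp only [mul_one, one_mul] at hleft hright
    exact (hleft.add hright).congr_left fun p => by ring

theorem BoundedClose.div_const (hf : BoundedClose l ε f f₀) (a : ℂ) :
    BoundedClose l ε (fun p => f p / a) fun p => f₀ p / a := by
  simpa only [div_eq_mul_inv] using hf.mul (boundedClose_const l ε a⁻¹)

theorem BoundedClose.star (hf : BoundedClose l ε f f₀) :
    BoundedClose l ε (fun p => star (f p)) fun p => star (f₀ p) where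
  left := Asymptotics.isBigO_norm_left.1 <| by simpa only [norm_star] using hf.left.norm_left
  right := Asymptotics.isBigO_norm_left.1 <| by simpa only [norm_star] using hf.right.norm_left
  sub := Asymptotics.isBigO_norm_left.1 <| by
    simpa only [← star_sub, norm_star] using hf.sub.norm_left

theorem BoundedClose.sum {κ : Type*} {s : Finset κ} {F F₀ : κ → T → ℂ}
    (h : ∀ i ∈ s, BoundedClose l ε (F i) (F₀ i)) :
    BoundedClose l ε (fun p => ∑ i ∈ s, F i p) fun p => ∑ i ∈ s, F₀ i p where
  left := Asymptotics.IsBigO.fun_sum fun i hi => (h i hi).left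
  right := Asymptotics.IsBigO.fun_sum fun i hi => (h i hi).right
  sub := by
    simp only [← Finset.sum_sub_distrib]
    exact Asymptotics.IsBigO.fun_sum fun i hi => (h i hi).sub

variable {ι m : Type*} [Fintype m]

/-- Each kernel vector has norm at least `1`. -/
def IsNormalized (χ : Matrix ι m ℂ) : Prop := ∀ j, 1 ≤ ∑ c, ‖χ j c‖ ^ 2

theorem IsNormalized.ne_zero {χ : Matrix ι m ℂ} (h : IsNormalized χ) (j : ι) : χ j ≠ 0 := by
  intro h0
  have h1 := h j
  simp only [h0, Pi.zero_apply, norm_zero, zero_pow two_ne_zero, Finset.sum_const_zero] at h1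
  exact absurd h1 (by norm_num)

variable {χ χ₀ : T → Matrix ι m ℂ}

theorem boundedClose_gram (hχ : ∀ j c, BoundedClose l ε (fun p => χ p j c) fun p => χ₀ p j c)
    (k : ι → ℂ) (i n : ι) :
    BoundedClose l ε (fun p => gram k (χ p) i n) fun p => gram k (χ₀ p) i n :=
  (boundedClose_const l ε (cauchyGram k i n)).mul
    (BoundedClose.sum (s := Finset.univ) fun c _ => (hχ i c).mul (hχ n c).star)

variable [Fintype ι] [DecidableEq ι] {k : ι → ℂ}

theorem exists_gram_inv_bound (hk : IsDiscreteSpectrum k) :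
    ∃ K, ∀ χ : Matrix ι m ℂ, IsNormalized χ → ∀ i n, ‖(gram k χ)⁻¹ i n‖ ≤ K := by
  obtain ⟨l, hl, hcoercive⟩ := exists_gram_coercive (m := m) hk
  refine ⟨l⁻¹, fun χ hχ i n => ?_⟩
  set v := (gram k χ)⁻¹.col n with hv
  have hGv : gram k χ *ᵥ v = Pi.single n 1 := by
    rw [hv, ← Matrix.mulVec_single_one, Matrix.mulVec_mulVec,
      Matrix.mul_nonsing_inv _ (gram_det_ne_zero hk hχ.ne_zero).isUnit, Matrix.one_mulVec]
  have hentry (j) : l * ‖v j‖ ^ 2 ≤ ‖v n‖ := calc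
    l * ‖v j‖ ^ 2 ≤ l * ((∑ c, ‖χ j c‖ ^ 2) * ‖v j‖ ^ 2) := by
      gcongr
      exact le_mul_of_one_le_left (sq_nonneg _) (hχ j)
    _ ≤ l * ∑ j, (∑ c, ‖χ j c‖ ^ 2) * ‖v j‖ ^ 2 := by
      gcongr
      exact Finset.single_le_sum (f := fun j => (∑ c, ‖χ j c‖ ^ 2) * ‖v j‖ ^ 2)
        (fun j _ => by positivity) (Finset.mem_univ j)
    _ ≤ (star v ⬝ᵥ gram k χ *ᵥ v).re := hcoercive χ v
    _ ≤ ‖v n‖ := by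
      rw [hGv, dotProduct_single_one]
      exact (Complex.re_le_norm _).trans_eq (norm_star _)
  have hn : ‖v n‖ ≤ l⁻¹ := by
    refine le_of_mul_le_mul_left ?_ hl
    nlinarith [hentry n, norm_nonneg (v n), mul_inv_cancel₀ hl.ne']
  refine le_of_sq_le_sq (le_of_mul_le_mul_left ?_ hl) (inv_nonneg.2 hl.le)
  calc l * ‖v i‖ ^ 2 ≤ ‖v n‖ := hentry i
    _ ≤ l⁻¹ := hn
    _ = l * l⁻¹ ^ 2 := by field_simp

theorem boundedClose_gram_inv (hk : IsDiscreteSpectrum k)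
    (hχ : ∀ j c, BoundedClose l ε (fun p => χ p j c) fun p => χ₀ p j c)
    (hnorm : ∀ᶠ p in l, IsNormalized (χ p)) (hnorm₀ : ∀ᶠ p in l, IsNormalized (χ₀ p))
    (i n : ι) :
    BoundedClose l ε (fun p => (gram k (χ p))⁻¹ i n) fun p => (gram k (χ₀ p))⁻¹ i n := by
  obtain ⟨K, hK⟩ := exists_gram_inv_bound (m := m) hk
  have hbound {χ : T → Matrix ι m ℂ} (h : ∀ᶠ p in l, IsNormalized (χ p)) (i n) :
      (fun p => (gram k (χ p))⁻¹ i n) =O[l] fun _ => (1 : ℝ) :=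
    Asymptotics.IsBigO.of_bound K <| h.mono fun p hp => by
      simpa only [norm_one, mul_one] using hK _ hp i n
  refine ⟨hbound hnorm i n, hbound hnorm₀ i n, ?_⟩
  have hsum : (fun p => ∑ b, (∑ a, (gram k (χ p))⁻¹ i a * (gram k (χ₀ p) a b - gram k (χ p) a b)) *
      (gram k (χ₀ p))⁻¹ b n) =O[l] ε := by
    refine Asymptotics.IsBigO.fun_sum fun b _ => ?_
    have hinner := Asymptotics.IsBigO.fun_sum (s := Finset.univ) fun a _ =>
      (hbound hnorm i a).mul ((boundedClose_gram hχ k a b).sub.symm)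
    simpa only [one_mul, mul_one] using hinner.mul (hbound hnorm₀ b n)
  refine hsum.congr' ?_ EventuallyEq.rfl
  filter_upwards [hnorm, hnorm₀] with p hp hp₀
  have hunit {χ : Matrix ι m ℂ} (h : IsNormalized χ) : IsUnit (gram k χ) :=
    (Matrix.isUnit_iff_isUnit_det _).2 (gram_det_ne_zero hk h.ne_zero).isUnit
  rw [← Matrix.sub_apply, Matrix.inv_sub_inv (iff_of_true (hunit hp) (hunit hp₀))]
  rfl

theorem boundedClose_gramPairing (hk : IsDiscreteSpectrum k)
    (hχ : ∀ j c, BoundedClose l ε (fun p => χ p j c) fun p => χ₀ p j c)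
    (hnorm : ∀ᶠ p in l, IsNormalized (χ p)) (hnorm₀ : ∀ᶠ p in l, IsNormalized (χ₀ p))
    {f f₀ g g₀ : T → ι → ℂ} (hf : ∀ j, BoundedClose l ε (fun p => f p j) fun p => f₀ p j)
    (hg : ∀ j, BoundedClose l ε (fun p => g p j) fun p => g₀ p j) :
    BoundedClose l ε (fun p => gramPairing k (χ p) (f p) (g p))
      fun p => gramPairing k (χ₀ p) (f₀ p) (g₀ p) :=
  .sum (s := Finset.univ) fun i _ => (hg i).star.mul <| .sum (s := Finset.univ) fun n _ =>
    (boundedClose_gram_inv hk hχ hnorm hnorm₀ i n).mul (hf n)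

variable {k : Fin N → ℂ} {χ χ₀ : T → Matrix (Fin N) (Fin 2) ℂ}

theorem isBigO_valueA_sub (hk : IsDiscreteSpectrum k)
    (hχ : ∀ j c, BoundedClose l ε (fun p => χ p j c) fun p => χ₀ p j c)
    (hnorm : ∀ᶠ p in l, IsNormalized (χ p)) (hnorm₀ : ∀ᶠ p in l, IsNormalized (χ₀ p)) :
    (fun p => valueA k (χ p) - valueA k (χ₀ p)) =O[l] ε :=
  ((boundedClose_const l ε 4).mul (boundedClose_gramPairing hk hχ hnorm hnorm₀
    (fun j => hχ j 0) fun j => hχ j 1)).sub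

theorem isBigO_valueB_sub (hk : IsDiscreteSpectrum k) (α β : ℝ)
    (hχ : ∀ j c, BoundedClose l ε (fun p => χ p j c) fun p => χ₀ p j c)
    (hnorm : ∀ᶠ p in l, IsNormalized (χ p)) (hnorm₀ : ∀ᶠ p in l, IsNormalized (χ₀ p)) :
    (fun p => valueB α β k (χ p) - valueB α β k (χ₀ p)) =O[l] ε :=
  have hpairing {f f₀ g g₀ : T → Fin N → ℂ} := boundedClose_gramPairing hk hχ hnorm hnorm₀
    (f := f) (f₀ := f₀) (g := g) (g₀ := g₀)
  have hdiv (j) := (hχ j 1).div_const (k j)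
  ((boundedClose_const l ε _).mul ((hpairing (fun j => hχ j 0) hdiv).mul
    (hpairing hdiv fun j => hχ j 0))).sub

end Stability

/-! Estimates in the cone -/

theorem integrable_nu {r : ℝ → ℂ} (hr : MemLp r 2 volume) : Integrable (nu r) := by
  have hsq : Integrable (fun s => ‖r s‖ ^ 2) := by
    simpa using hr.integrable_norm_pow (by norm_num)
  suffices h : Integrable (fun s => Real.log (1 + ‖r s‖ ^ 2)) from h.const_mul _
  refine hsq.mono' (Real.measurable_log.comp_aemeasurable
    (hsq.aestronglyMeasurable.aemeasurable.const_add 1)).aestronglyMeasurable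
    (Eventually.of_forall fun s => ?_)
  have hone : 1 ≤ 1 + ‖r s‖ ^ 2 := le_add_of_nonneg_right (sq_nonneg _)
  rw [Real.norm_of_nonneg (Real.log_nonneg hone)]
  linarith [Real.log_le_sub_one_of_pos (zero_lt_one.trans_le hone)]

theorem exists_delta_bound {r : ℝ → ℂ} (hν : Integrable (nu r)) {z : ℂ} (hz : z.im ≠ 0) :
    ∃ K : ℝ, ∀ α κ, ‖delta α r κ z‖ ≤ K ∧ ‖(delta α r κ z)⁻¹‖ ≤ K := by
  have hbound : Integrable (fun s => |z.im|⁻¹ * ‖nu r s‖) := hν.norm.const_mul _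
  refine ⟨Real.exp (∫ s, |z.im|⁻¹ * ‖nu r s‖), fun α κ => ?_⟩
  set J := ∫ s in jumpSet α κ, (nu r s : ℂ) / ((s : ℂ) - z) with hJ
  have hJ_le : ‖J‖ ≤ ∫ s, |z.im|⁻¹ * ‖nu r s‖ := by
    refine (norm_integral_le_of_norm_le hbound.integrableOn
      (Eventually.of_forall fun s => ?_)).trans
      (setIntegral_le_integral hbound (Eventually.of_forall fun s => by positivity))
    have him : |z.im| ≤ ‖(s : ℂ) - z‖ := by
      simpa using Complex.abs_im_le_norm ((s : ℂ) - z)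
    rw [norm_div, Complex.norm_real, div_eq_inv_mul]
    gcongr
  have hre := abs_le.1 ((Complex.abs_re_le_norm (Complex.I * J)).trans_eq
    (by rw [norm_mul, Complex.norm_I, one_mul]))
  rw [norm_inv, delta, ← hJ, Complex.norm_exp, ← Real.exp_neg, Real.exp_le_exp, Real.exp_le_exp]
  constructor <;> linarith

theorem exists_modulatedConst_bound (hk : IsDiscreteSpectrum k) {r : ℝ → ℂ}
    (hν : Integrable (nu r)) (c : Fin N → ℂ) (j : Fin N) :
    ∃ K : ℝ, ∀ α κ, ‖modulatedConst α r k c κ j‖ ≤ K ∧ ‖(modulatedConst α r k c κ j)⁻¹‖ ≤ K := by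
  obtain ⟨L, hL⟩ := exists_delta_bound hν (hk.im_pos j).ne'
  refine ⟨max (‖c j‖ * L ^ 2) (‖c j‖⁻¹ * L ^ 2), fun α κ => ?_⟩
  obtain ⟨hdelta, hdelta_inv⟩ := hL α κ
  constructor
  · refine le_max_of_le_left ?_
    rw [modulatedConst, norm_mul, ← inv_pow, norm_pow]
    gcongr
  · refine le_max_of_le_right ?_
    rw [modulatedConst, mul_inv, inv_inv, norm_mul, norm_inv, norm_pow]
    gcongr

theorem tTheta_im (α x t : ℝ) (z : ℂ) :
    (tTheta α x t z).im = z.im * (x - velocity α z * t) := by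
  have htheta : tTheta α x t z = z * x - ((α * t / 4 : ℝ) : ℂ) * z⁻¹ := by
    rw [tTheta]
    push_cast
    rw [div_eq_mul_inv, mul_inv, div_eq_mul_inv]
    ring
  rw [htheta, Complex.sub_im, Complex.im_mul_ofReal, Complex.im_ofReal_mul, Complex.inv_im,
    Complex.normSq_eq_norm_sq, velocity]
  ring

theorem norm_exp_tTheta (α x t : ℝ) (z : ℂ) : ‖Complex.exp (2 * Complex.I * tTheta α x t z)‖ =
    Real.exp (-2 * z.im * (x - velocity α z * t)) := by
  have hre : (2 * Complex.I * tTheta α x t z).re = -2 * (tTheta α x t z).im := by simp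
  rw [Complex.norm_exp, hre, tTheta_im, mul_assoc]

theorem norm_kernelRatio (α x t : ℝ) (k : Fin N → ℂ) (a : ℂ) (j : Fin N) :
    ‖kernelRatio α x t k a j‖ = ‖a‖ * ‖s11Deriv k Finset.univ j‖ *
      Real.exp (-2 * (k j).im * (x - velocity α (k j) * t)) := by
  rw [kernelRatio, norm_neg, norm_mul, norm_mul, norm_exp_tTheta]
  ring

/-- The points of the cone at positive times at which the phase has real stationary points. -/
def stationaryCone (α x₁ x₂ v₁ v₂ : ℝ) : Set (ℝ × ℝ) :=
  {p | p ∈ cone x₁ x₂ v₁ v₂ ∧ 0 < p.2 ∧ 0 < -(α * p.2) / (4 * p.1)}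

theorem exists_time_mem_stationaryCone {α v₁ v₂ : ℝ} (x₁ x₂ : ℝ) (hv₁ : α * v₁ < 0)
    (hv₂ : α * v₂ < 0) :
    ∃ T : ℝ, 0 < T ∧ ∀ p ∈ cone x₁ x₂ v₁ v₂, T ≤ p.2 → p ∈ stationaryCone α x₁ x₂ v₁ v₂ := by
  rcases lt_trichotomy α 0 with hα | rfl | hα
  · have hv : 0 < v₁ := pos_of_mul_neg_right hv₁ hα.le
    have hT : 0 < (|x₁| + 1) / v₁ := by positivity
    refine ⟨_, hT, fun p hp hTp => ⟨hp, hT.trans_le hTp, ?_⟩⟩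
    have ht : 0 < p.2 := hT.trans_le hTp
    obtain ⟨x₀, hx₀, v, hvI, hx⟩ := hp
    rw [div_le_iff₀ hv] at hTp
    have hspeed : v₁ * p.2 ≤ v * p.2 := mul_le_mul_of_nonneg_right hvI.1 ht.le
    have hxpos : 0 < p.1 := by linarith [neg_abs_le x₁, hx₀.1]
    exact div_pos (neg_pos.2 (mul_neg_of_neg_of_pos hα ht)) (by positivity)
  · simp at hv₁
  · have hv : 0 < -v₂ := neg_pos.2 (neg_of_mul_neg_right hv₂ hα.le)
    have hT : 0 < (|x₂| + 1) / (-v₂) := by positivity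
    refine ⟨_, hT, fun p hp hTp => ⟨hp, hT.trans_le hTp, ?_⟩⟩
    have ht : 0 < p.2 := hT.trans_le hTp
    obtain ⟨x₀, hx₀, v, hvI, hx⟩ := hp
    rw [div_le_iff₀ hv] at hTp
    have hspeed : v * p.2 ≤ v₂ * p.2 := mul_le_mul_of_nonneg_right hvI.2 ht.le
    have hxneg : p.1 < 0 := by linarith [le_abs_self x₂, hx₀.2]
    exact div_pos_of_neg_of_neg (neg_neg_of_pos (mul_pos hα ht)) (by linarith)

theorem mem_fastSet_iff (ht : 0 < t) (hpos : 0 < -(α * t) / (4 * x)) (hj : k j ≠ 0) :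
    j ∈ fastSet α k (k0 α x t) ↔ x < velocity α (k j) * t := by
  have hn : 0 < ‖k j‖ := norm_pos_iff.2 hj
  have hv : velocity α (k j) * t = -(α * t) / (4 * ‖k j‖ ^ 2) := by
    rw [velocity]; ring
  rw [hv, lt_div_iff₀ (by positivity)]
  rcases lt_trichotomy α 0 with hα | rfl | hα
  · have hx : 0 < 4 * x :=
      (div_pos_iff_of_pos_left (neg_pos.2 (mul_neg_of_neg_of_pos hα ht))).1 hpos
    simp only [fastSet, hα, if_true, deltaMinus, Finset.mem_filter_univ]
    rw [k0, Real.lt_sqrt hn.le, lt_div_iff₀ hx]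
    constructor <;> intro h <;> linarith
  · simp at hpos
  · have hx : 4 * x < 0 := by
      by_contra! hx
      exact hpos.not_ge (div_nonpos_of_nonpos_of_nonneg (neg_neg_of_pos (mul_pos hα ht)).le hx)
    simp only [fastSet, not_lt.2 hα.le, if_false, deltaPlus, Finset.mem_filter_univ]
    rw [k0, Real.sqrt_lt' hn, div_lt_iff_of_neg hx]
    constructor <;> intro h <;> linarith

theorem infDist_mul_sub_le {x₁ x₂ v₁ v₂ : ℝ} (hxt : (x, t) ∈ cone x₁ x₂ v₁ v₂) (ht : 0 ≤ t)
    (w : ℝ) : Metric.infDist w (Set.Icc v₁ v₂) * t - (|x₁| + |x₂|) ≤ |x - w * t| := by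
  obtain ⟨x₀, hx₀, v, hv, hx : x = x₀ + v * t⟩ := hxt
  have hdist : Metric.infDist w (Set.Icc v₁ v₂) ≤ |v - w| := by
    simpa only [dist_comm w, Real.dist_eq] using Metric.infDist_le_dist_of_mem (x := w) hv
  have hx₀_le : |x₀| ≤ |x₁| + |x₂| :=
    (abs_le_max_abs_abs hx₀.1 hx₀.2).trans (max_le_add_of_nonneg (abs_nonneg _) (abs_nonneg _))
  have hsplit : |v - w| * t = |(x - w * t) - x₀| := by
    nth_rw 1 [← abs_of_nonneg ht]
    rw [← abs_mul, hx]
    congr 1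
    ring
  linarith [abs_sub (x - w * t) x₀, mul_le_mul_of_nonneg_right hdist ht]

theorem exp_le_of_rate {x₁ x₂ v₁ v₂ w μ h : ℝ} (hxt : (x, t) ∈ cone x₁ x₂ v₁ v₂) (ht : 0 ≤ t)
    (hh : 0 ≤ h) (hμ : μ ≤ h * Metric.infDist w (Set.Icc v₁ v₂)) :
    Real.exp (-2 * h * |x - w * t|) ≤
      Real.exp (2 * h * (|x₁| + |x₂|)) * Real.exp (-2 * μ * t) := by
  rw [← Real.exp_add, Real.exp_le_exp]
  linarith [mul_le_mul_of_nonneg_left (infDist_mul_sub_le hxt ht w) hh,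
    mul_le_mul_of_nonneg_right hμ ht]

/-! The normalized kernel vectors at the points of the cone -/

/-- The vector with entry `1` at the dominant index `d`, and entry `m` at the other index. -/
def normalizedKernel (d : Fin 2) (m : ℂ) : Fin 2 → ℂ := Function.update (fun _ => m) d 1

theorem one_le_sum_normalizedKernel (d : Fin 2) (m : ℂ) :
    1 ≤ ∑ c, ‖normalizedKernel d m c‖ ^ 2 := by
  refine le_of_eq_of_le ?_
    (Finset.single_le_sum (fun c _ => sq_nonneg ‖normalizedKernel d m c‖) (Finset.mem_univ d))
  rw [normalizedKernel, Function.update_self, norm_one, one_pow]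

theorem boundedClose_normalizedKernel {T : Type*} {l : Filter T} {ε : T → ℝ} {m m₀ : T → ℂ}
    (h : BoundedClose l ε m m₀) (d : T → Fin 2) (c : Fin 2) :
    BoundedClose l ε (fun p => normalizedKernel (d p) (m p) c)
      fun p => normalizedKernel (d p) (m₀ p) c := by
  have hbound {m : T → ℂ} (hm : m =O[l] fun _ => (1 : ℝ)) :
      (fun p => normalizedKernel (d p) (m p) c) =O[l] fun _ => (1 : ℝ) := by
    refine .trans (.of_norm_le fun p => ?_)
      ((Asymptotics.isBigO_refl (fun _ => (1 : ℝ)) l).add hm.norm_left)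
    rw [normalizedKernel, Function.update_apply]
    split_ifs
    · simp
    · simp
  refine ⟨hbound h.left, hbound h.right, .trans (.of_norm_le fun p => ?_) h.sub.norm_left⟩
  simp only [normalizedKernel, Function.update_apply]
  split_ifs
  · simp
  · exact le_rfl

section ConeKernels

variable {v₁ v₂ : ℝ} {r : ℝ → ℂ} {k c : Fin N → ℂ} {p : ℝ × ℝ}

/-- The quotient of the entries of the kernel vector at `k_j` of the full problem at the point
`p`. -/
def modulatedRatio (α : ℝ) (r : ℝ → ℂ) (k c : Fin N → ℂ) (p : ℝ × ℝ) (j : Fin N) : ℂ :=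
  kernelRatio α p.1 p.2 k (modulatedConst α r k c (k0 α p.1 p.2) j) j

open Classical in
/-- The index of the dominant entry of the kernel vector at `k_j`. Inside `𝓘` this is an entry of
largest norm, and outside `𝓘` it is given by the velocity of the soliton. -/
def dominantEntry (α v₁ v₂ : ℝ) (r : ℝ → ℂ) (k c : Fin N → ℂ) (p : ℝ × ℝ) (j : Fin N) : Fin 2 :=
  if j ∈ inside α v₁ v₂ k then if ‖modulatedRatio α r k c p j‖ ≤ 1 then 0 else 1
  else if j ∈ fastSet α k (k0 α p.1 p.2) then 1 else 0

/-- The other entry of the kernel vector at `k_j` of the full problem when the dominant one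
is `1`. -/
def minorEntry (α v₁ v₂ : ℝ) (r : ℝ → ℂ) (k c : Fin N → ℂ) (p : ℝ × ℝ) (j : Fin N) : ℂ :=
  if dominantEntry α v₁ v₂ r k c p j = 0 then modulatedRatio α r k c p j
  else (modulatedRatio α r k c p j)⁻¹

/-- The normalized kernel vectors of the full problem at the point `p`. -/
def fullKernel (α v₁ v₂ : ℝ) (r : ℝ → ℂ) (k c : Fin N → ℂ) (p : ℝ × ℝ) :
    Matrix (Fin N) (Fin 2) ℂ :=
  .of fun j => normalizedKernel (dominantEntry α v₁ v₂ r k c p j) (minorEntry α v₁ v₂ r k c p j)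

open Classical in
/-- The entries `minorEntry` for the eigenvalues inside `𝓘`, and `0` for the others. -/
def insideMinorEntry (α v₁ v₂ : ℝ) (r : ℝ → ℂ) (k c : Fin N → ℂ) (p : ℝ × ℝ) (j : Fin N) : ℂ :=
  if j ∈ inside α v₁ v₂ k then minorEntry α v₁ v₂ r k c p j else 0

/-- The normalized kernel vectors at the point `p` when the eigenvalues outside `𝓘` are
trivial. -/
def insideKernel (α v₁ v₂ : ℝ) (r : ℝ → ℂ) (k c : Fin N → ℂ) (p : ℝ × ℝ) :
    Matrix (Fin N) (Fin 2) ℂ :=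
  .of fun j =>
    normalizedKernel (dominantEntry α v₁ v₂ r k c p j) (insideMinorEntry α v₁ v₂ r k c p j)

theorem isNormalized_fullKernel : IsNormalized (fullKernel α v₁ v₂ r k c p) := fun _ =>
  one_le_sum_normalizedKernel _ _

theorem isNormalized_insideKernel : IsNormalized (insideKernel α v₁ v₂ r k c p) := fun _ =>
  one_le_sum_normalizedKernel _ _

theorem modulatedRatio_ne_zero (hk : IsDiscreteSpectrum k) (hc : c j ≠ 0) :
    modulatedRatio α r k c p j ≠ 0 :=
  neg_ne_zero.2 (mul_ne_zero (mul_ne_zero (modulatedConst_ne_zero hc _ _ _ _)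
    (Complex.exp_ne_zero _)) (s11Deriv_ne_zero hk _ _))

theorem fullKernel_ratio (hk : IsDiscreteSpectrum k) (hc : c j ≠ 0) :
    fullKernel α v₁ v₂ r k c p j 1 =
      modulatedRatio α r k c p j * fullKernel α v₁ v₂ r k c p j 0 := by
  rcases Fin.eq_zero_or_eq_succ (dominantEntry α v₁ v₂ r k c p j) with hd | ⟨i, hd⟩
  · simp [fullKernel, minorEntry, normalizedKernel, hd]
  · obtain rfl : i = 0 := Subsingleton.elim _ _
    simp [fullKernel, minorEntry, normalizedKernel, hd, modulatedRatio_ne_zero hk hc]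

theorem isInsideKernel_insideKernel (hk : IsDiscreteSpectrum k) (hc : ∀ j, c j ≠ 0) :
    IsInsideKernel α v₁ v₂ r k c (k0 α p.1 p.2) p.1 p.2 (insideKernel α v₁ v₂ r k c p) where
  ne_zero := isNormalized_insideKernel.ne_zero
  ratio j hj := by
    have hrow : insideKernel α v₁ v₂ r k c p j = fullKernel α v₁ v₂ r k c p j := by
      ext i
      simp only [insideKernel, fullKernel, insideMinorEntry, Matrix.of_apply, hj, if_true]
    rw [hrow]
    exact fullKernel_ratio hk (hc j)
  apply_zero j hj hfast := by
    simp [insideKernel, insideMinorEntry, dominantEntry, normalizedKernel, hj, hfast]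
  apply_one j hj hslow := by
    simp [insideKernel, insideMinorEntry, dominantEntry, normalizedKernel, hj, hslow]

theorem norm_minorEntry_le_one (hj : j ∈ inside α v₁ v₂ k) :
    ‖minorEntry α v₁ v₂ r k c p j‖ ≤ 1 := by
  by_cases h : ‖modulatedRatio α r k c p j‖ ≤ 1
  · simp [minorEntry, dominantEntry, hj, h]
  · simpa [minorEntry, dominantEntry, hj, h] using inv_le_one_of_one_le₀ (not_le.1 h).le

theorem exists_modulatedRatio_bound (hk : IsDiscreteSpectrum k) (hν : Integrable (nu r))
    (c : Fin N → ℂ) (j : Fin N) :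
    ∃ K : ℝ, ∀ α p,
      ‖modulatedRatio α r k c p j‖ ≤
        K * Real.exp (-2 * (k j).im * (p.1 - velocity α (k j) * p.2)) ∧
      ‖(modulatedRatio α r k c p j)⁻¹‖ ≤
        K * Real.exp (2 * (k j).im * (p.1 - velocity α (k j) * p.2)) := by
  obtain ⟨L, hL⟩ := exists_modulatedConst_bound hk hν c j
  set b := ‖s11Deriv k Finset.univ j‖ with hb
  refine ⟨max (L * b) (L * b⁻¹), fun α p => ?_⟩
  obtain ⟨hconst, hconst_inv⟩ := hL α (k0 α p.1 p.2)
  rw [norm_inv] at hconst_inv ⊢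
  rw [modulatedRatio, norm_kernelRatio, mul_inv, mul_inv, ← Real.exp_neg, ← hb, neg_mul,
    neg_mul, neg_neg]
  constructor
  · gcongr
    exact le_max_of_le_left (by gcongr)
  · gcongr
    exact le_max_of_le_right (by gcongr)

variable {x₁ x₂ μ : ℝ}

theorem exists_minorEntry_bound (hk : IsDiscreteSpectrum k) (hν : Integrable (nu r))
    (c : Fin N → ℂ) (hj : j ∉ inside α v₁ v₂ k) :
    ∃ K : ℝ, ∀ p ∈ stationaryCone α x₁ x₂ v₁ v₂, ‖minorEntry α v₁ v₂ r k c p j‖ ≤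
      K * Real.exp (-2 * (k j).im * |p.1 - velocity α (k j) * p.2|) := by
  obtain ⟨K, hK⟩ := exists_modulatedRatio_bound hk hν c j
  refine ⟨K, fun p hp => ?_⟩
  obtain ⟨-, ht, hpos⟩ := hp
  obtain ⟨hratio, hratio_inv⟩ := hK α p
  have hfast_iff := mem_fastSet_iff ht hpos (hk.ne_zero j)
  by_cases hfast : j ∈ fastSet α k (k0 α p.1 p.2)
  · rw [abs_of_neg (sub_neg.2 (hfast_iff.1 hfast)), neg_mul, neg_mul_neg]
    simpa [minorEntry, dominantEntry, hj, hfast] using hratio_inv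
  · rw [abs_of_nonneg (sub_nonneg.2 (not_lt.1 (mt hfast_iff.2 hfast)))]
    simpa [minorEntry, dominantEntry, hj, hfast] using hratio

theorem boundedClose_minorEntry (hk : IsDiscreteSpectrum k) (hν : Integrable (nu r))
    (c : Fin N → ℂ) (hμ : μ ∈ lowerBounds (rateSet α v₁ v₂ k)) (j : Fin N) :
    BoundedClose (𝓟 (stationaryCone α x₁ x₂ v₁ v₂)) (fun p => Real.exp (-2 * μ * p.2))
      (fun p => minorEntry α v₁ v₂ r k c p j) fun p => insideMinorEntry α v₁ v₂ r k c p j := by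
  by_cases hj : j ∈ inside α v₁ v₂ k
  · have hbound : (fun p => minorEntry α v₁ v₂ r k c p j)
        =O[𝓟 (stationaryCone α x₁ x₂ v₁ v₂)] fun _ => (1 : ℝ) :=
      .of_norm_le fun p => norm_minorEntry_le_one hj
    simp only [insideMinorEntry, hj, if_true]
    refine ⟨hbound, hbound, ?_⟩
    simpa only [sub_self] using Asymptotics.isBigO_zero _ _
  simp only [insideMinorEntry, hj, if_false]
  obtain ⟨K, hK⟩ := exists_minorEntry_bound (x₁ := x₁) (x₂ := x₂) hk hν c hj
  have hdecay : (fun p => minorEntry α v₁ v₂ r k c p j) =O[𝓟 (stationaryCone α x₁ x₂ v₁ v₂)]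
      fun p => Real.exp (-2 * (k j).im * |p.1 - velocity α (k j) * p.2|) :=
    Asymptotics.isBigO_principal.2 ⟨K, fun p hp => by
      rw [Real.norm_of_nonneg (Real.exp_pos _).le]
      exact hK p hp⟩
  have hrate : μ ≤ (k j).im * Metric.infDist (velocity α (k j)) (Set.Icc v₁ v₂) :=
    hμ ⟨j, by simpa [inside] using hj, rfl⟩
  refine ⟨hdecay.trans (.of_norm_le fun p => ?_), Asymptotics.isBigO_zero _ _, ?_⟩
  · rw [Real.norm_of_nonneg (Real.exp_pos _).le, Real.exp_le_one_iff]
    exact mul_nonpos_of_nonpos_of_nonneg (by linarith [hk.im_pos j]) (abs_nonneg _)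
  · simp only [sub_zero]
    refine hdecay.trans (Asymptotics.isBigO_principal.2
      ⟨Real.exp (2 * (k j).im * (|x₁| + |x₂|)), fun p hp => ?_⟩)
    rw [Real.norm_of_nonneg (Real.exp_pos _).le, Real.norm_of_nonneg (Real.exp_pos _).le]
    exact exp_le_of_rate hp.1 hp.2.1.le (hk.im_pos j).le hrate

theorem boundedClose_kernel (hk : IsDiscreteSpectrum k) (hν : Integrable (nu r))
    (c : Fin N → ℂ) (hμ : μ ∈ lowerBounds (rateSet α v₁ v₂ k)) (j : Fin N) (i : Fin 2) :
    BoundedClose (𝓟 (stationaryCone α x₁ x₂ v₁ v₂)) (fun p => Real.exp (-2 * μ * p.2))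
      (fun p => fullKernel α v₁ v₂ r k c p j i) fun p => insideKernel α v₁ v₂ r k c p j i :=
  boundedClose_normalizedKernel (boundedClose_minorEntry hk hν c hμ j) _ i

theorem exists_value_sub_bound (hk : IsDiscreteSpectrum k) (hν : Integrable (nu r))
    (c : Fin N → ℂ) (hμ : μ ∈ lowerBounds (rateSet α v₁ v₂ k)) (β : ℝ) :
    ∃ C : ℝ, ∀ p ∈ stationaryCone α x₁ x₂ v₁ v₂,
      ‖valueA k (fullKernel α v₁ v₂ r k c p) - valueA k (insideKernel α v₁ v₂ r k c p)‖ ≤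
        C * Real.exp (-2 * μ * p.2) ∧
      ‖valueB α β k (fullKernel α v₁ v₂ r k c p) -
        valueB α β k (insideKernel α v₁ v₂ r k c p)‖ ≤ C * Real.exp (-2 * μ * p.2) := by
  have hclose := boundedClose_kernel (x₁ := x₁) (x₂ := x₂) hk hν c hμ
  have hfull : ∀ᶠ p in 𝓟 (stationaryCone α x₁ x₂ v₁ v₂),
      IsNormalized (fullKernel α v₁ v₂ r k c p) := .of_forall fun _ => isNormalized_fullKernel
  have hinside : ∀ᶠ p in 𝓟 (stationaryCone α x₁ x₂ v₁ v₂),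
      IsNormalized (insideKernel α v₁ v₂ r k c p) := .of_forall fun _ => isNormalized_insideKernel
  obtain ⟨C, hC⟩ := Asymptotics.isBigO_principal.1
    ((isBigO_valueA_sub hk hclose hfull hinside).prod_left
      (isBigO_valueB_sub hk α β hclose hfull hinside))
  refine ⟨C, fun p hp => max_le_iff.1 ((hC p hp).trans_eq ?_)⟩
  rw [Real.norm_of_nonneg (Real.exp_pos _).le]

end ConeKernels

end ABSystem

end

theorem mainTheorem4_general {N : ℕ} (α β : ℝ) (hβ : β ≠ 0)
    (k c : Fin N → ℂ) (hk : Function.Injective k) (hkim : ∀ j, 0 < (k j).im)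
    (hc : ∀ j, c j ≠ 0) (r : ℝ → ℂ) (hν : Integrable (ABSystem.nu r))
    (x₁ x₂ v₁ v₂ : ℝ) (hv₁ : α * v₁ < 0) (hv₂ : α * v₂ < 0)
    (μ : ℝ) (hμ : μ ∈ lowerBounds (ABSystem.rateSet α v₁ v₂ k)) :
    ∃ C T : ℝ, 0 < T ∧ ∀ x t : ℝ, (x, t) ∈ ABSystem.cone x₁ x₂ v₁ v₂ → T ≤ t →
      0 < -(α * t) / (4 * x) ∧
      ∃ A B A' B' : ℂ,
        (∀ nabla : Finset (Fin N),
          ABSystem.IsSolitonValue α β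
              (ABSystem.fullData α r k c (ABSystem.k0 α x t) nabla) x t A B ∧
            ABSystem.IsSolitonValue α β
              (ABSystem.insideData α v₁ v₂ r k c (ABSystem.k0 α x t) nabla) x t A' B') ∧
        ‖A - A'‖ ≤ C * Real.exp (-2 * μ * t) ∧
        ‖B - B'‖ ≤ C * Real.exp (-2 * μ * t) := by
  have hspec : ABSystem.IsDiscreteSpectrum k := ⟨hk, hkim⟩
  obtain ⟨T, hT, hcone⟩ := ABSystem.exists_time_mem_stationaryCone x₁ x₂ hv₁ hv₂
  obtain ⟨C, hC⟩ := ABSystem.exists_value_sub_bound (x₁ := x₁) (x₂ := x₂) hspec hν c hμ β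
  refine ⟨C, T, hT, fun x t hxt ht => ?_⟩
  have hp := hcone (x, t) hxt ht
  refine ⟨hp.2.2, _, _, _, _, fun nabla => ⟨?_, ?_⟩, hC (x, t) hp⟩
  · exact ABSystem.fullData_isSolitonValue hspec hc nabla
      ABSystem.isNormalized_fullKernel.ne_zero
      (fun j => ABSystem.fullKernel_ratio (p := (x, t)) hspec (hc j)) β
  · exact ABSystem.insideData_isSolitonValue hspec hc
      (ABSystem.isInsideKernel_insideKernel (p := (x, t)) hspec hc) nabla β

theorem mainTheorem4 {N : ℕ} (α β : ℝ) (hα : α ≠ 0) (hβ : β ≠ 0)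
    (k c : Fin N → ℂ) (hk : Function.Injective k) (hkim : ∀ j, 0 < (k j).im)
    (hc : ∀ j, c j ≠ 0) (r : ℝ → ℂ) (hr : MemLp r 2 volume)
    (x₁ x₂ v₁ v₂ : ℝ) (hx : x₁ < x₂) (hv : v₁ < v₂) (hv₁ : α * v₁ < 0) (hv₂ : α * v₂ < 0)
    (μ : ℝ) (hμ : (ABSystem.rateSet α v₁ v₂ k).Nonempty →
      IsLeast (ABSystem.rateSet α v₁ v₂ k) μ) :
    ∃ C T : ℝ, 0 < T ∧ ∀ x t : ℝ, (x, t) ∈ ABSystem.cone x₁ x₂ v₁ v₂ → T ≤ t →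
      0 < -(α * t) / (4 * x) ∧
      ∃ A B A' B' : ℂ,
        (∀ nabla : Finset (Fin N),
          nabla = ABSystem.deltaMinus k (ABSystem.k0 α x t) ∨
            nabla = ABSystem.deltaPlus k (ABSystem.k0 α x t) →
          ABSystem.IsSolitonValue α β
              (ABSystem.fullData α r k c (ABSystem.k0 α x t) nabla) x t A B ∧
            ABSystem.IsSolitonValue α β
              (ABSystem.insideData α v₁ v₂ r k c (ABSystem.k0 α x t) nabla) x t A' B') ∧
        ‖A - A'‖ ≤ C * Real.exp (-2 * μ * t) ∧
        ‖B - B'‖ ≤ C * Real.exp (-2 * μ * t) := by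
  obtain ⟨C, T, hT, h⟩ := mainTheorem4_general α β hβ k c hk hkim hc r (ABSystem.integrable_nu hr)
    x₁ x₂ v₁ v₂ hv₁ hv₂ μ fun ρ hρ => (hμ ⟨ρ, hρ⟩).2 hρ
  refine ⟨C, T, hT, fun x t hxt ht => ?_⟩
  obtain ⟨hpos, A, B, A', B', hvalue, hbound⟩ := h x t hxt ht
  exact ⟨hpos, A, B, A', B', fun nabla _ => hvalue nabla, hbound⟩
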